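/- Write points of $\mathbb{R}^{2n}$ as $z=(\boldsymbol{x},\boldsymbol{u})$ with $\boldsymbol{x},\boldsymbol{u}\in\mathbb{R}^n$. Let $f\in\mathcal{S}(\mathbb{R}^{2n})$. **Transforms.** Given a map $c:\{1,\dots,n\}\to\{1,\dots,m\}$, put for $\boldsymbol{\alpha}\in(\mathbb{R}\setminus\{0\})^m$, $\bar{\boldsymbol{x}}\in\mathbb{R}^n$ $$P_cf(\boldsymbol{\alpha},\bar{\boldsymbol{x}})=\Big(\prod_{k=1}^n|\alpha_{c(k)}|\Big)^{-1}\int_{\mathbb{R}^n}f\Big(\Big(\tfrac{1}{\alpha_{c(k)}}\bar x_k+\big(1-\tfrac1{\alpha_{c(k)}}\big)u_k\Big)_{k=1}^n,\boldsymbol{u}\Big)\,d\boldsymbol{u},$$ $$P_c^*g(\boldsymbol{x},\boldsymbol{u})=\int_{\mathbb{R}^m}g\big(\boldsymbol{\alpha},(\alpha_{c(k)}x_k+(1-\alpha_{c(k)})u_k)_{k=1}^n\big)\,d\boldsymbol{\alpha}.$$ $\bar P$ is $P_c$ with $m=n$, $c(k)=k$; $\widetilde P$ is $P_c$ with $m=\lceil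 n/2\rceil$, $c(k)=\lceil k/2\rceil$ (so $x_{2i-1},x_{2i}$ share the parameter $\alpha_i$ and, for odd $n$, $x_n$ has its own parameter $\alpha_{(n+1)/2}$). **Kernels.** For $1\le i\le\lfloor n/2\rfloor$ let $\phi_i=\arg(x_{2i-1},u_{2i-1})$, $\varphi_i=\arg(x_{2i},u_{2i})\in[0,2\pi)$. Let $\prod_i\delta(\sin(\phi_i-\varphi_i))$ be the unique Radon measure $\nu$ on $\mathbb{R}^{2n}$ such that, for every continuous compactly supported $\psi$ and every nonnegative $\rho\in C_c^\infty(\mathbb{R})$ with $\int\rho=1$, $$\int\psi\,d\nu=\lim_{\varepsilon\to0^+}\int_{\mathbb{R}^{2n}}\prod_i\varepsilon^{-1}\rho\big(\varepsilon^{-1}\sin(\phi_i-\varphi_i)\big)\,\psi\,d\boldsymbol{x}\,d\boldsymbol{u}$$ (an empty product being $1$). Consider the positive kernels $$\bar K=\prod_{k=1}^n|x_k-u_k|^{-1},\qquad \widetilde K=\frac{\prod_{i=1}^{n/2}\delta(\sin(\phi_i-\varphi_i))}{\prod_{k=1}^{n}\|(x_k,u_k)\|}\ (n\text{ even}),\qquad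 \widetilde K=\frac{\prod_{i=1}^{(n-1)/2}\delta(\sin(\phi_i-\varphi_i))}{|x_n-u_n|\prod_{k=1}^{n-1}\|(x_k,u_k)\|}\ (n\text{ odd}),$$ regarded as measures ($\bar K$ as a density with respect to Lebesgue measure), and put $(K*f)(z)=\int f(z-w)\,dK(w)$. **Proposition.** The integrals defining $\bar Pf(\boldsymbol{\alpha},\bar{\boldsymbol{x}})$ and $\widetilde Pf(\boldsymbol{\alpha},\bar{\boldsymbol{x}})$ converge absolutely whenever all entries of $\boldsymbol{\alpha}$ are nonzero, the limit measure $\prod_i\delta(\sin(\phi_i-\varphi_i))$ exists, and the following hold at every $z=(\boldsymbol{x},\boldsymbol{u})\in\mathbb{R}^{2n}$. (i) $\bar P^*\bar Pf=\bar K*f$, in the following sense: $\bar P^*\bar P|f|(z)=(\bar K*|f|)(z)$ in $[0,\infty]$; if $(\bar K*|f|)(z)<\infty$, then the integral over $\boldsymbol{\alpha}$ defining $\bar P^*\bar Pf(z)$ converges absolutely and $\bar P^*\bar Pf(z)=(\bar K*f)(z)$; and, without any restriction on $f$, for every $A\in\mathbb{R}$ both sides of $$\int_{\{|\alpha_k|\le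 A\ \forall k\}}\bar Pf\big(\boldsymbol{\alpha},(\alpha_kx_k+(1-\alpha_k)u_k)_k\big)\,d\boldsymbol{\alpha}=\int_{\{(\boldsymbol{y},\boldsymbol{v}):\,|v_k|\le A|y_k-v_k|\ \forall k\}}f(\boldsymbol{x}-\boldsymbol{y},\boldsymbol{u}-\boldsymbol{v})\,d\bar K(\boldsymbol{y},\boldsymbol{v})$$ converge absolutely and they are equal. (ii) If $n$ is even, then $\widetilde P^*\widetilde P|f|(z)=(\widetilde K*|f|)(z)$, the integrals defining $\widetilde P^*\widetilde Pf(z)$ and $(\widetilde K*f)(z)$ converge absolutely, and $\widetilde P^*\widetilde Pf(z)=(\widetilde K*f)(z)$. If $n$ is odd, then $\widetilde P^*\widetilde Pf=\widetilde K*f$ in the same sense as in (i), where in the truncated identity only the last parameter is truncated, i.e. the integral over $\boldsymbol{\alpha}$ is over $\{|\alpha_{(n+1)/2}|\le A\}$ and the integral against $\widetilde K$ is over $\{|v_n|\le A|y_n-v_n|\}$. -/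

import Mathlib

open MeasureTheory Filter Topology
open scoped ENNReal ContDiff BigOperators

noncomputable section

namespace Photography

/-- The phase space `ℝⁿ × ℝⁿ`, with points `z = (x, u)`. -/
abbrev Phase (n : ℕ) : Type := (Fin n → ℝ) × (Fin n → ℝ)

/-! ### Photography transforms and their duals

A coupling `c : Fin n → ι` says which parameter `α_{c k}` multiplies the `k`-th pair of
variables `(x_k, u_k)`. -/

section Transforms

variable {n : ℕ} {ι : Type} [Fintype ι]

/-- The point `((x̄_k / α_{c k} + (1 - 1 / α_{c k}) u_k)_k, u)` at which `f` is evaluated. -/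
def ray (c : Fin n → ι) (α : ι → ℝ) (xbar u : Fin n → ℝ) : Phase n :=
  (fun k => 1 / α (c k) * xbar k + (1 - 1 / α (c k)) * u k, u)

/-- The point `(α_{c k} x_k + (1 - α_{c k}) u_k)_k`. -/
def focal (c : Fin n → ι) (α : ι → ℝ) (z : Phase n) : Fin n → ℝ :=
  fun k => α (c k) * z.1 k + (1 - α (c k)) * z.2 k

/-- The photography transform with coupling `c`, for parameters `α` with nonzero entries:
`(∏ₖ |α_{c k}|)⁻¹ ∫ f((x̄_k / α_{c k} + (1 - 1 / α_{c k}) u_k)_k, u) du`. -/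
def transform (c : Fin n → ι) (f : Phase n → ℂ) (α : ι → ℝ) (xbar : Fin n → ℝ) : ℂ :=
  ((∏ k, |α (c k)|)⁻¹ : ℝ) • ∫ u, f (ray c α xbar u)

/-- The dual operator `(x, u) ↦ ∫ g(α, (α_{c k} x_k + (1 - α_{c k}) u_k)_k) dα`. -/
def dual (c : Fin n → ι) (g : (ι → ℝ) → (Fin n → ℝ) → ℂ) (z : Phase n) : ℂ :=
  ∫ α, g α (focal c α z)

/-- The same transform for `[0, ∞]`-valued functions. -/
def etransform (c : Fin n → ι) (f : Phase n → ℝ≥0∞) (α : ι → ℝ) (xbar : Fin n → ℝ) : ℝ≥0∞ :=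
  (∏ k, ENNReal.ofReal |α (c k)|)⁻¹ * ∫⁻ u, f (ray c α xbar u)

/-- The same dual operator for `[0, ∞]`-valued functions. -/
def edual (c : Fin n → ι) (g : (ι → ℝ) → (Fin n → ℝ) → ℝ≥0∞) (z : Phase n) : ℝ≥0∞ :=
  ∫⁻ α, g α (focal c α z)

end Transforms

/-- The coupling of `P̄`: every pair `(x_k, u_k)` has its own parameter. -/
def barCoupling (n : ℕ) : Fin n → Fin n := id

/-- The coupling of `P̃`: the (zero-based) indices `2i` and `2i + 1` share the parameter `α_i`;
for odd `n` the last index has a parameter of its own. There are `n / 2` parameters for even `n`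
and `(n + 1) / 2` for odd `n`. -/
def tildeCoupling (n : ℕ) : Fin n → Fin ((n + 1) / 2) := fun k => ⟨k / 2, by omega⟩

/-! ### Kernels -/

/-- Convolution of a (positive) kernel measure with a function. -/
def conv {n : ℕ} (K : Measure (Phase n)) (f : Phase n → ℂ) (z : Phase n) : ℂ :=
  ∫ w, f (z - w) ∂K

/-- Convolution of a (positive) kernel measure with a `[0, ∞]`-valued function. -/
def econv {n : ℕ} (K : Measure (Phase n)) (f : Phase n → ℝ≥0∞) (z : Phase n) : ℝ≥0∞ :=
  ∫⁻ w, f (z - w) ∂K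

section Delta

variable {X : Type*} [TopologicalSpace X] [MeasureSpace X] {κ : Type*} [Fintype κ]

/-- A standard mollifier profile on the line. -/
structure IsMollifier (ρ : ℝ → ℝ) : Prop where
  smooth : ContDiff ℝ ∞ ρ
  compact : HasCompactSupport ρ
  nonneg : ∀ t, 0 ≤ ρ t
  integral_eq_one : ∫ t, ρ t = 1

/-- `ν` is the generalized function `δ(h) = ∏ᵢ δ(hᵢ)`: it is a Radon measure and the limit, tested
against continuous compactly supported functions, of `∏ᵢ ρ_ε(hᵢ)` with `ρ_ε(t) = ε⁻¹ ρ(t / ε)`,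
for every mollifier `ρ`. -/
structure IsDelta (h : X → κ → ℝ) (ν : Measure X) : Prop where
  finite : IsFiniteMeasureOnCompacts ν
  tendsto : ∀ ρ : ℝ → ℝ, IsMollifier ρ → ∀ ψ : X → ℝ, Continuous ψ → HasCompactSupport ψ →
    Tendsto (fun ε : ℝ => ∫ w, (∏ i, ε⁻¹ * ρ (h w i / ε)) * ψ w) (𝓝[>] 0) (𝓝 (∫ w, ψ w ∂ν))

open Classical in
/-- The measure `δ(h) = ∏ᵢ δ(hᵢ)` (zero if the limit does not exist). -/
def delta (h : X → κ → ℝ) : Measure X :=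
  if H : ∃ ν : Measure X, IsDelta h ν then H.choose else 0

end Delta

/-- There is at most one measure `δ(h)` on phase space. -/
theorem IsDelta.unique {n : ℕ} {κ : Type*} [Fintype κ] {h : Phase n → κ → ℝ}
    {ν ν' : Measure (Phase n)} (hν : IsDelta h ν) (hν' : IsDelta h ν') : ν = ν' := by
  have := hν.finite
  have := hν'.finite
  obtain ⟨b⟩ : Nonempty (ContDiffBump (0 : ℝ)) := inferInstance
  have hb : IsMollifier (b.normed volume) :=
    ⟨b.contDiff_normed, b.hasCompactSupport_normed, b.nonneg_normed, b.integral_normed⟩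
  refine Measure.ext_of_integral_eq_on_compactlySupported fun ψ => ?_
  exact tendsto_nhds_unique (hν.tendsto _ hb ψ ψ.continuous ψ.hasCompactSupport)
    (hν'.tendsto _ hb ψ ψ.continuous ψ.hasCompactSupport)

/-- The argument of `(a, b)` in `[0, 2π)`. -/
def angle (a b : ℝ) : ℝ := toIcoMod Real.two_pi_pos 0 (Complex.arg ⟨a, b⟩)

/-- The Euclidean norm of `(a, b)`. -/
def norm2 (a b : ℝ) : ℝ := Real.sqrt (a ^ 2 + b ^ 2)

/-- The first index `2i` (zero-based) of the `i`-th pair. -/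
def fstIdx {n : ℕ} (i : Fin (n / 2)) : Fin n := ⟨2 * i, by omega⟩

/-- The second index `2i + 1` (zero-based) of the `i`-th pair. -/
def sndIdx {n : ℕ} (i : Fin (n / 2)) : Fin n := ⟨2 * i + 1, by omega⟩

/-- The last index, for odd `n`. -/
def lastIdx {n : ℕ} (hn : Odd n) : Fin n := ⟨n - 1, by have := hn.pos; omega⟩

/-- `(x, u) ↦ (sin (φ_i - ϕ_i))_i`, where `φ_i` and `ϕ_i` are the arguments of the first and of the
second point `(x_k, u_k)` of the `i`-th pair. -/
def sinDiff (n : ℕ) (w : Phase n) (i : Fin (n / 2)) : ℝ :=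
  Real.sin (angle (w.1 (fstIdx i)) (w.2 (fstIdx i)) - angle (w.1 (sndIdx i)) (w.2 (sndIdx i)))

/-- The kernel `∏ₖ |x_k - u_k|⁻¹`. -/
def barKernel (n : ℕ) : Measure (Phase n) :=
  volume.withDensity fun w => ∏ k, (ENNReal.ofReal |w.1 k - w.2 k|)⁻¹

/-- `∏ᵢ (‖(x_{2i}, u_{2i})‖ ‖(x_{2i+1}, u_{2i+1})‖)⁻¹`, over all `n / 2` pairs. -/
def pairDensity (n : ℕ) (w : Phase n) : ℝ≥0∞ :=
  ∏ i : Fin (n / 2), (ENNReal.ofReal (norm2 (w.1 (fstIdx i)) (w.2 (fstIdx i)) *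
    norm2 (w.1 (sndIdx i)) (w.2 (sndIdx i))))⁻¹

/-- For even `n`, the kernel `∏ᵢ δ(sin (φ_i - ϕ_i)) / ∏ₖ ‖(x_k, u_k)‖`. -/
def evenKernel (n : ℕ) : Measure (Phase n) :=
  (delta (sinDiff n)).withDensity (pairDensity n)

/-- For odd `n`, the kernel
`∏ᵢ δ(sin (φ_i - ϕ_i)) / (|x_last - u_last| ∏_{k ≠ last} ‖(x_k, u_k)‖)`. -/
def oddKernel {n : ℕ} (hn : Odd n) : Measure (Phase n) :=
  (delta (sinDiff n)).withDensity fun w =>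
    pairDensity n w * (ENNReal.ofReal |w.1 (lastIdx hn) - w.2 (lastIdx hn)|)⁻¹

end Photography

end

/-!
After the translation `u ↦ u_z - u` in the integral defining `P f`, `P* P f (z)` becomes the
integral of `f (z - w)` over the rays `w = (((1 - 1 / α_{c k}) v_k)_k, v)` with respect to
`∏ₖ |α_{c k}|⁻¹ dα dv`, so `P* P f = K * f` says that `(α, v) ↦ w` pushes this measure forward to
the kernel `K`. If every variable has its own parameter, this is the change of variables
`x = (1 - 1 / α) v`, `u = v`, in which `|x - u| = |v| / |α|`. If two variables share a parameter,
their points `p` and `q` are proportional, and `(α, v, v') ↦ (p, λ)`, with `λ = v' / v` and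
`q = λ p`, has Jacobian `α⁻²`, so that the kernel is `dp dλ` on the proportional pairs.

To identify it with `δ(sin (φ - ϕ)) / (‖p‖ ‖q‖)`, write `J p = (p_2, -p_1)` and use the coordinates
`(p, λ, s)` with `q = λ √(1 - s²) p + |λ| s J p`. The sine of the difference of the arguments of `p`
and `q` is then `s`, and the Jacobian at `s = 0` is `|λ| ‖p‖² = ‖p‖ ‖q‖`.

A parameter `α` that occurs in `m` variables contributes `O((1 + α²)^(-m / 2))` to `P f (α, ·)` on
the rays through `z`. This is integrable for `m = 2`, whereas for `m = 1` it needs truncation.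
-/

noncomputable section

namespace Photography

/-! ### Changes of variables -/

theorem lintegral_pi_fin_prod {N : ℕ} {E : Fin N → Type*} [∀ i, MeasurableSpace (E i)]
    (μ : ∀ i, Measure (E i)) [∀ i, SigmaFinite (μ i)] (f : ∀ i, E i → ℝ≥0∞)
    (hf : ∀ i, Measurable (f i)) :
    ∫⁻ x, ∏ i, f i (x i) ∂Measure.pi μ = ∏ i, ∫⁻ x, f i x ∂μ i := by
  induction N with
  | zero => simp
  | succ N ih =>
    rw [← ((measurePreserving_piFinSuccAbove μ 0).symm).lintegral_comp_emb
      (MeasurableEquiv.measurableEmbedding _)]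
    simp_rw [MeasurableEquiv.piFinSuccAbove_symm_apply, Fin.insertNthEquiv,
      Fin.prod_univ_succ, Fin.insertNth_zero]
    rw [← ih (fun i => μ i.succ) (fun i => f i.succ) fun i => hf i.succ]
    exact lintegral_prod_mul (hf 0).aemeasurable (Finset.measurable_prod _ fun i _ =>
      (hf _).comp (measurable_pi_apply i)).aemeasurable

section PiDensity

variable {ι : Type*} [Fintype ι] {E : ι → Type*} [∀ i, MeasurableSpace (E i)]
  {μ : ∀ i, Measure (E i)} [∀ i, SigmaFinite (μ i)] {f : ∀ i, E i → ℝ≥0∞}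

theorem lintegral_pi_prod (hf : ∀ i, Measurable (f i)) :
    ∫⁻ x, ∏ i, f i (x i) ∂Measure.pi μ = ∏ i, ∫⁻ x, f i x ∂μ i := by
  let e := (Fintype.equivFin ι).symm
  rw [← (measurePreserving_piCongrLeft _ e).lintegral_comp_emb
    (MeasurableEquiv.measurableEmbedding _)]
  simp_rw [← e.prod_comp, MeasurableEquiv.coe_piCongrLeft, Equiv.piCongrLeft_apply_apply]
  exact lintegral_pi_fin_prod _ (fun i => f (e i)) fun i => hf (e i)

theorem pi_withDensity (hf : ∀ i, Measurable (f i)) [∀ i, SigmaFinite ((μ i).withDensity (f i))] :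
    Measure.pi (fun i => (μ i).withDensity (f i)) =
      (Measure.pi μ).withDensity fun x => ∏ i, f i (x i) := by
  refine Measure.pi_eq fun s hs => ?_
  rw [withDensity_apply _ (MeasurableSet.univ_pi hs), Measure.restrict_pi_pi, lintegral_pi_prod hf]
  exact Finset.prod_congr rfl fun i _ => (withDensity_apply _ (hs i)).symm

end PiDensity

theorem lintegral_map_withDensity {X Y : Type*} [MeasurableSpace X] [MeasurableSpace Y]
    {μ : Measure X} {T : X → Y} (hT : Measurable T) {d : X → ℝ≥0∞} (hd : Measurable d)
    {F : Y → ℝ≥0∞} (hF : Measurable F) :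
    ∫⁻ y, F y ∂(μ.withDensity d).map T = ∫⁻ x, d x * F (T x) ∂μ := by
  rw [lintegral_map hF hT, lintegral_withDensity_eq_lintegral_mul _ hd (by fun_prop)]
  rfl

theorem integral_map_withDensity_ofReal {X Y : Type*} [MeasurableSpace X] [MeasurableSpace Y]
    {μ : Measure X} {T : X → Y} (hT : Measurable T) {J : X → ℝ} (hJ : Measurable J)
    (hJ0 : ∀ x, 0 ≤ J x) {F : Y → ℝ} (hF : Measurable F) :
    ∫ y, F y ∂(μ.withDensity fun x => ENNReal.ofReal (J x)).map T = ∫ x, J x * F (T x) ∂μ := by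
  rw [integral_map hT.aemeasurable hF.aestronglyMeasurable,
    integral_withDensity_eq_integral_toReal_smul hJ.ennreal_ofReal
      (ae_of_all _ fun _ => ENNReal.ofReal_lt_top)]
  simp only [ENNReal.toReal_ofReal (hJ0 _), smul_eq_mul]

section Jacobian

variable {X Y Z : Type*} [MeasureSpace X] [MeasureSpace Y] [MeasureSpace Z]

/-- `T` parametrizes `Y`, up to null sets and essentially injectively, with Jacobian `J`: the
substitution `y = T x` turns `dy` into `J x dx`. -/
structure HasJacobian (T : X → Y) (J : X → ℝ) : Prop where
  measurable : Measurable T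
  measurable_jacobian : Measurable J
  jacobian_nonneg : ∀ x, 0 ≤ J x
  map_eq : (volume.withDensity fun x => ENNReal.ofReal (J x)).map T = volume

namespace HasJacobian

variable {T : X → Y} {J : X → ℝ}

theorem lintegral_eq (h : HasJacobian T J) {F : Y → ℝ≥0∞} (hF : Measurable F) :
    ∫⁻ y, F y = ∫⁻ x, ENNReal.ofReal (J x) * F (T x) := by
  conv_lhs => rw [← h.map_eq]
  exact lintegral_map_withDensity h.measurable h.measurable_jacobian.ennreal_ofReal hF

theorem integral_eq (h : HasJacobian T J) {F : Y → ℝ} (hF : Measurable F) :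
    ∫ y, F y = ∫ x, J x * F (T x) := by
  conv_lhs => rw [← h.map_eq]
  exact integral_map_withDensity_ofReal h.measurable h.measurable_jacobian h.jacobian_nonneg hF

theorem integrable_mul_comp (h : HasJacobian T J) {F : Y → ℝ} (hF : Integrable F) :
    Integrable fun x => J x * F (T x) := by
  rw [← h.map_eq] at hF
  have hcomp := hF.comp_measurable h.measurable
  rw [integrable_withDensity_iff_integrable_smul' h.measurable_jacobian.ennreal_ofReal
    (ae_of_all _ fun _ => ENNReal.ofReal_lt_top)] at hcomp
  simpa only [ENNReal.toReal_ofReal (h.jacobian_nonneg _), smul_eq_mul,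
    Function.comp_apply] using hcomp

theorem of_lintegral (hT : Measurable T) (hJ : Measurable J) (hJ0 : ∀ x, 0 ≤ J x)
    (h : ∀ F : Y → ℝ≥0∞, Measurable F → ∫⁻ y, F y = ∫⁻ x, ENNReal.ofReal (J x) * F (T x)) :
    HasJacobian T J := by
  refine ⟨hT, hJ, hJ0, Measure.ext_of_lintegral _ fun F hF => ?_⟩
  rw [lintegral_map_withDensity hT hJ.ennreal_ofReal hF, h F hF]

theorem of_measurePreserving (hT : MeasurePreserving T) : HasJacobian T 1 :=
  of_lintegral hT.measurable measurable_one (fun _ => zero_le_one) fun F hF => by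
    simpa using (hT.lintegral_comp hF).symm

theorem congr_ae (h : HasJacobian T J) {T' : X → Y} {J' : X → ℝ} (hT' : Measurable T')
    (hJ' : Measurable J') (hJ0 : ∀ x, 0 ≤ J' x) (hTT' : T' =ᵐ[volume] T)
    (hJJ' : J' =ᵐ[volume] J) : HasJacobian T' J' :=
  of_lintegral hT' hJ' hJ0 fun F hF => by
    rw [h.lintegral_eq hF]
    refine lintegral_congr_ae ?_
    filter_upwards [hTT', hJJ'] with x hx hx'
    rw [hx, hx']

theorem comp {S : Y → Z} {K : Y → ℝ} (hS : HasJacobian S K) (hT : HasJacobian T J) :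
    HasJacobian (S ∘ T) fun x => J x * K (T x) := by
  refine of_lintegral (hS.measurable.comp hT.measurable)
    (hT.measurable_jacobian.mul (hS.measurable_jacobian.comp hT.measurable))
    (fun x => mul_nonneg (hT.jacobian_nonneg x) (hS.jacobian_nonneg _)) fun F hF => ?_
  have hK := hS.measurable_jacobian
  have hSm := hS.measurable
  rw [hS.lintegral_eq hF, hT.lintegral_eq (by fun_prop)]
  simp only [ENNReal.ofReal_mul (hT.jacobian_nonneg _), mul_assoc, Function.comp_apply]

theorem prodMk_left [SFinite (volume : Measure Y)] [SFinite (volume : Measure Z)]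
    {T : X → Y → Z} {J : X → Y → ℝ} (hT : Measurable T.uncurry) (hJ : Measurable J.uncurry)
    (hJ0 : ∀ x y, 0 ≤ J x y) (h : ∀ᵐ x, HasJacobian (T x) (J x)) :
    HasJacobian (fun p : X × Y => (p.1, T p.1 p.2)) fun p => J p.1 p.2 := by
  have hm : Measurable fun p : X × Y => (p.1, T p.1 p.2) := measurable_fst.prodMk hT
  refine of_lintegral hm hJ (fun _ => hJ0 _ _) fun F hF => ?_
  have hJF : Measurable fun p : X × Y => ENNReal.ofReal (J p.1 p.2) * F (p.1, T p.1 p.2) :=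
    hJ.ennreal_ofReal.mul (hF.comp hm)
  rw [Measure.volume_eq_prod, lintegral_prod _ hF.aemeasurable, Measure.volume_eq_prod,
    lintegral_prod _ hJF.aemeasurable]
  exact lintegral_congr_ae (h.mono fun x hx => hx.lintegral_eq (hF.comp measurable_prodMk_left))

theorem prodMap {W : Type*} [MeasureSpace W] [SFinite (volume : Measure X)]
    [SFinite (volume : Measure Y)] [SFinite (volume : Measure Z)] [SFinite (volume : Measure W)]
    {S : Z → W} {K : Z → ℝ} (hT : HasJacobian T J) (hS : HasJacobian S K) :
    HasJacobian (Prod.map T S) fun p => J p.1 * K p.2 := by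
  refine ⟨hT.measurable.prodMap hS.measurable, (hT.measurable_jacobian.comp measurable_fst).mul
    (hS.measurable_jacobian.comp measurable_snd),
    fun p => mul_nonneg (hT.jacobian_nonneg _) (hS.jacobian_nonneg _), ?_⟩
  simp only [ENNReal.ofReal_mul (hT.jacobian_nonneg _)]
  rw [Measure.volume_eq_prod, ← prod_withDensity hT.measurable_jacobian.ennreal_ofReal
    hS.measurable_jacobian.ennreal_ofReal, ← Measure.map_prod_map _ _ hT.measurable hS.measurable,
    hT.map_eq, hS.map_eq, Measure.volume_eq_prod]

theorem piMap {ι : Type*} [Fintype ι] {X Y : ι → Type*} [∀ i, MeasureSpace (X i)]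
    [∀ i, MeasureSpace (Y i)] [∀ i, SigmaFinite (volume : Measure (X i))]
    [∀ i, SigmaFinite (volume : Measure (Y i))] {T : ∀ i, X i → Y i} {J : ∀ i, X i → ℝ}
    (h : ∀ i, HasJacobian (T i) (J i)) :
    HasJacobian (Pi.map T) fun x => ∏ i, J i (x i) := by
  have hm : Measurable (Pi.map T) := measurable_pi_lambda _ fun i =>
    (h i).measurable.comp (measurable_pi_apply i)
  refine ⟨hm, Finset.measurable_prod _ fun i _ =>
    (h i).measurable_jacobian.comp (measurable_pi_apply i),
    fun x => Finset.prod_nonneg fun i _ => (h i).jacobian_nonneg _, ?_⟩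
  simp only [ENNReal.ofReal_prod_of_nonneg fun i _ => (h i).jacobian_nonneg _]
  rw [volume_pi, ← pi_withDensity fun i => (h i).measurable_jacobian.ennreal_ofReal]
  exact (measurePreserving_pi _ _ fun i => ⟨(h i).measurable, (h i).map_eq⟩).map_eq

theorem measurePreserving_withDensity (h : HasJacobian T J) {d : Y → ℝ≥0∞} (hd : Measurable d) :
    MeasurePreserving T (volume.withDensity fun x => ENNReal.ofReal (J x) * d (T x))
      (volume.withDensity d) := by
  refine ⟨h.measurable, Measure.ext_of_lintegral _ fun F hF => ?_⟩
  have hT := h.measurable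
  have hJ := h.measurable_jacobian
  rw [lintegral_map_withDensity hT (by fun_prop) hF,
    lintegral_withDensity_eq_lintegral_mul _ hd hF, h.lintegral_eq (hd.mul hF)]
  simp only [Pi.mul_apply, mul_assoc]

end HasJacobian

end Jacobian

theorem HasJacobian.of_hasDerivAt {s : Set ℝ} (hs : MeasurableSet s) {f f' : ℝ → ℝ}
    (hf : Measurable f) (hf' : Measurable f') (hderiv : ∀ x ∈ s, HasDerivAt f (f' x) x)
    (hinj : s.InjOn f) (hsurj : f '' s =ᵐ[volume] Set.univ) :
    HasJacobian f (s.indicator fun x => |f' x|) := by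
  refine of_lintegral hf (hf'.abs.indicator hs)
    (fun _ => Set.indicator_nonneg (fun _ _ => abs_nonneg _) _) fun F _ => ?_
  rw [← setLIntegral_univ, ← setLIntegral_congr hsurj,
    lintegral_image_eq_lintegral_abs_deriv_mul hs (fun x hx => (hderiv x hx).hasDerivWithinAt) hinj,
    ← lintegral_indicator hs]
  refine lintegral_congr fun x => ?_
  by_cases hx : x ∈ s <;> simp [hx]

theorem hasJacobian_affine {c : ℝ} (hc : c ≠ 0) (d : ℝ) :
    HasJacobian (fun s => c * s + d) fun _ => |c| := by
  have hderiv (x : ℝ) : HasDerivAt (fun s => c * s + d) c x := by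
    simpa only [mul_one, id] using ((hasDerivAt_id x).const_mul c).add_const d
  have hsurj : Function.Surjective fun s => c * s + d := fun y => ⟨(y - d) / c, by field_simp; ring⟩
  have h := HasJacobian.of_hasDerivAt MeasurableSet.univ (by fun_prop) measurable_const
    (fun x _ => hderiv x) (fun x _ y _ hxy => by simpa [hc] using hxy)
    (by rw [Set.image_univ, hsurj.range_eq]; rfl)
  rwa [Set.indicator_univ] at h

theorem hasJacobian_one_div : HasJacobian (fun x : ℝ => 1 / x) fun x => (x ^ 2)⁻¹ := by
  have hsurj : (fun x : ℝ => 1 / x) '' {0}ᶜ = {0}ᶜ := by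
    simp only [one_div]
    exact (Set.image_inv_eq_inv).trans (by ext; simp)
  have hJ : (fun x : ℝ => (x ^ 2)⁻¹) = ({0}ᶜ : Set ℝ).indicator fun x => |-(x ^ 2)⁻¹| := by
    funext x
    by_cases hx : x = 0 <;> simp [hx]
  rw [hJ]
  refine .of_hasDerivAt (measurableSet_singleton 0).compl (by fun_prop) (by fun_prop)
    (fun x hx => by simpa only [one_div] using hasDerivAt_inv hx)
    (fun x _ y _ hxy => by simpa using hxy) ?_
  rw [hsurj]
  exact compl_mem_ae_iff.2 (measure_singleton 0) |> eventuallyEq_univ.2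

theorem ae_ne_zero {E : Type*} [MeasureSpace E] [Zero E] [NullSingletonClass (volume : Measure E)] :
    ∀ᵐ x : E, x ≠ 0 := by
  simp [ae_iff]

/-! ### Rays -/

/-- The point of phase space `ℝ × ℝ` with `u`-coordinate `v` on the ray with parameter `α`
through the origin. -/
def rayPoint (a : ℝ × ℝ) : ℝ × ℝ := ((1 - 1 / a.1) * a.2, a.2)

theorem hasJacobian_rayPoint : HasJacobian rayPoint fun a => (a.1 ^ 2)⁻¹ * |a.2| := by
  have hslope : ∀ᵐ v : ℝ, HasJacobian (fun α => -v * (1 / α) + v) fun α => (α ^ 2)⁻¹ * |v| := by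
    filter_upwards [ae_ne_zero] with v hv
    rw [← abs_neg v]
    exact (hasJacobian_affine (neg_ne_zero.2 hv) v).comp hasJacobian_one_div
  have hswap : HasJacobian (Prod.swap : ℝ × ℝ → ℝ × ℝ) 1 :=
    .of_measurePreserving Measure.measurePreserving_swap
  have hfib := HasJacobian.prodMk_left (T := fun v α : ℝ => -v * (1 / α) + v)
    (J := fun v α => (α ^ 2)⁻¹ * |v|) (by fun_prop)
    (by fun_prop) (fun _ _ => by positivity) hslope
  convert hswap.comp (hfib.comp hswap) using 1
  · funext a
    simp only [rayPoint, Function.comp_apply, Prod.swap_prod_mk, Prod.fst_swap, Prod.snd_swap]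
    congr 1
    ring
  · funext a
    simp

/-- The point `p = rayPoint (α, v₁)` and the factor `λ` for which `rayPoint (α, v₂) = λ p`. -/
def rayLine (a : ℝ × (ℝ × ℝ)) : (ℝ × ℝ) × ℝ := (rayPoint (a.1, a.2.1), a.2.2 / a.2.1)

/-- The pair of proportional vectors `(p, λ p)`. -/
def propPair (b : (ℝ × ℝ) × ℝ) : (ℝ × ℝ) × (ℝ × ℝ) := (b.1, b.2 • b.1)

theorem propPair_rayLine {a : ℝ × (ℝ × ℝ)} (h : a.2.1 ≠ 0) :
    propPair (rayLine a) = (rayPoint (a.1, a.2.1), rayPoint (a.1, a.2.2)) := by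
  simp only [propPair, rayLine, rayPoint, Prod.smul_mk, smul_eq_mul, Prod.mk.injEq, true_and]
  constructor <;> field_simp

theorem hasJacobian_rayLine : HasJacobian rayLine fun a => (a.1 ^ 2)⁻¹ := by
  have hassoc : HasJacobian (MeasurableEquiv.prodAssoc.symm : ℝ × (ℝ × ℝ) ≃ᵐ (ℝ × ℝ) × ℝ) 1 :=
    .of_measurePreserving (volume_preserving_prodAssoc.symm _)
  have hpoint := hasJacobian_rayPoint.prodMap (.of_measurePreserving (.id (volume : Measure ℝ)))
  have hp : ∀ᵐ p : ℝ × ℝ, p.2 ≠ 0 := Measure.quasiMeasurePreserving_snd.ae ae_ne_zero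
  have hscale := HasJacobian.prodMk_left (T := fun (p : ℝ × ℝ) (v : ℝ) => p.2⁻¹ * v + 0)
    (J := fun p _ => |p.2⁻¹|) (by fun_prop)
    (by fun_prop) (fun _ _ => abs_nonneg _)
    (hp.mono fun p hp => hasJacobian_affine (inv_ne_zero hp) 0)
  have h := hscale.comp (hpoint.comp hassoc)
  have hv : ∀ᵐ a : ℝ × (ℝ × ℝ), a.2.1 ≠ 0 := Measure.quasiMeasurePreserving_snd.ae
    (Measure.quasiMeasurePreserving_fst.ae ae_ne_zero)
  refine h.congr_ae (by unfold rayLine rayPoint; fun_prop) (by fun_prop) (fun _ => by positivity)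
    (ae_of_all _ fun a => ?_) (hv.mono fun a ha => ?_)
  · refine Prod.ext rfl ?_
    exact (div_eq_inv_mul _ _).trans (add_zero _).symm
  · change _ = (1 : ℝ) * ((a.1 ^ 2)⁻¹ * |a.2.1| * 1) * |a.2.1⁻¹|
    rw [abs_inv]
    field_simp

/-! ### Angular coordinates for pairs of plane vectors -/

/-- The squared Euclidean norm of a plane vector; the norm that Mathlib puts on `ℝ × ℝ` is the
maximum norm. -/
def normSq (p : ℝ × ℝ) : ℝ := p.1 ^ 2 + p.2 ^ 2

@[fun_prop]
theorem continuous_normSq : Continuous normSq := by unfold normSq; fun_prop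

theorem normSq_nonneg (p : ℝ × ℝ) : 0 ≤ normSq p := by unfold normSq; positivity

theorem normSq_pos {p : ℝ × ℝ} (hp : p ≠ 0) : 0 < normSq p := by
  refine (normSq_nonneg p).lt_of_ne' fun h => hp ?_
  rw [normSq, add_eq_zero_iff_of_nonneg (sq_nonneg _) (sq_nonneg _)] at h
  exact Prod.ext (pow_eq_zero_iff two_ne_zero |>.1 h.1) (pow_eq_zero_iff two_ne_zero |>.1 h.2)

/-- The vector with coordinates `y` in the orthogonal frame `p`, `(p.2, -p.1)`. -/
def inFrame (p y : ℝ × ℝ) : ℝ × ℝ := y.1 • p + y.2 • (p.2, -p.1)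

theorem hasJacobian_inFrame {p : ℝ × ℝ} (hp : p ≠ 0) :
    HasJacobian (inFrame p) fun _ => normSq p := by
  set T := Matrix.toLin (Module.Basis.finTwoProd ℝ) (Module.Basis.finTwoProd ℝ)
    !![p.1, p.2; p.2, -p.1] with hT
  have hframe : inFrame p = T := by
    funext y
    rw [hT, Matrix.toLin_finTwoProd_apply]
    ext <;> simp only [inFrame, Prod.fst_add, Prod.smul_fst, Prod.snd_add, Prod.smul_snd,
      smul_eq_mul] <;> ring
  have hdet : LinearMap.det T = -normSq p := by
    rw [hT, LinearMap.det_toLin, Matrix.det_fin_two_of, normSq]; ring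
  have hpos := normSq_pos hp
  refine ⟨by unfold inFrame; fun_prop, measurable_const, fun _ => hpos.le, ?_⟩
  rw [withDensity_const, Measure.map_smul, hframe, Measure.map_linearMap_addHaar_eq_smul_addHaar _
    (by rw [hdet]; linarith), smul_smul, hdet, inv_neg, abs_neg, abs_of_pos (inv_pos.2 hpos),
    ← ENNReal.ofReal_mul hpos.le, mul_inv_cancel₀ hpos.ne', ENNReal.ofReal_one, one_smul]

theorem sqrt_one_sub_sq_pos {s : ℝ} (hs : s ∈ Set.Ioo (-1 : ℝ) 1) : 0 < √(1 - s ^ 2) :=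
  Real.sqrt_pos.2 (by nlinarith [hs.1, hs.2])

theorem sqrt_one_sub_sq_eq_zero {s : ℝ} (hs : s ∉ Set.Ioo (-1 : ℝ) 1) : √(1 - s ^ 2) = 0 := by
  rw [Set.mem_Ioo, ← abs_lt, not_lt] at hs
  exact Real.sqrt_eq_zero_of_nonpos (sub_nonpos.2 ((one_le_sq_iff_one_le_abs s).2 hs))

theorem hasDerivAt_div_sqrt_one_sub_sq {s : ℝ} (hs : s ∈ Set.Ioo (-1 : ℝ) 1) :
    HasDerivAt (fun s : ℝ => s / √(1 - s ^ 2)) ((√(1 - s ^ 2) ^ 3)⁻¹) s := by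
  have hsqrt := sqrt_one_sub_sq_pos hs
  have hpos : 0 < 1 - s ^ 2 := Real.sqrt_pos.1 hsqrt
  have hinner : HasDerivAt (fun s : ℝ => 1 - s ^ 2) (-(2 * s)) s := by
    simpa using (hasDerivAt_pow 2 s).const_sub 1
  refine ((hasDerivAt_id s).div (hinner.sqrt hpos.ne') hsqrt.ne').congr_deriv ?_
  have hsq := Real.sq_sqrt hpos.le
  simp only [id]
  field_simp
  nlinarith

theorem image_div_sqrt_one_sub_sq :
    (fun s : ℝ => s / √(1 - s ^ 2)) '' Set.Ioo (-1) 1 = Set.univ := by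
  refine Set.eq_univ_of_forall fun y => ⟨y / √(1 + y ^ 2), ?_, ?_⟩
  · have : |y| < √(1 + y ^ 2) := Real.lt_sqrt_of_sq_lt (by rw [sq_abs]; linarith)
    rwa [Set.mem_Ioo, ← abs_lt, abs_div, abs_of_nonneg (Real.sqrt_nonneg _),
      div_lt_one (by positivity)]
  · have hpos : 0 < 1 + y ^ 2 := by positivity
    have : 1 - (y / √(1 + y ^ 2)) ^ 2 = (1 + y ^ 2)⁻¹ := by
      rw [div_pow, Real.sq_sqrt hpos.le]; field_simp; ring
    simp only [this, Real.sqrt_inv]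
    field_simp

theorem hasJacobian_div_sqrt_one_sub_sq :
    HasJacobian (fun s : ℝ => s / √(1 - s ^ 2)) fun s => (√(1 - s ^ 2) ^ 3)⁻¹ := by
  have hmono : StrictMonoOn (fun s : ℝ => s / √(1 - s ^ 2)) (Set.Ioo (-1) 1) := by
    refine strictMonoOn_of_deriv_pos (convex_Ioo _ _)
      (fun s hs => (hasDerivAt_div_sqrt_one_sub_sq hs).continuousAt.continuousWithinAt)
      fun s hs => ?_
    rw [interior_Ioo] at hs
    rw [(hasDerivAt_div_sqrt_one_sub_sq hs).deriv]
    exact inv_pos.2 (pow_pos (sqrt_one_sub_sq_pos hs) 3)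
  have hJ : (fun s : ℝ => (√(1 - s ^ 2) ^ 3)⁻¹) =
      (Set.Ioo (-1 : ℝ) 1).indicator fun s => |(√(1 - s ^ 2) ^ 3)⁻¹| := by
    funext s
    by_cases hs : s ∈ Set.Ioo (-1 : ℝ) 1
    · rw [Set.indicator_of_mem hs, abs_of_nonneg (by positivity)]
    · rw [Set.indicator_of_notMem hs, sqrt_one_sub_sq_eq_zero hs]; norm_num
  rw [hJ]
  exact .of_hasDerivAt measurableSet_Ioo (by fun_prop) (by fun_prop)
    (fun s hs => hasDerivAt_div_sqrt_one_sub_sq hs) hmono.injOn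
    (by rw [image_div_sqrt_one_sub_sq]; rfl)

/-- The vector of length `|l|` in the direction whose angle with the first axis has sine `s`, up to
signs, for `b = (l, s)`. -/
def sector (b : ℝ × ℝ) : ℝ × ℝ := (b.1 * √(1 - b.2 ^ 2), |b.1| * b.2)

theorem hasJacobian_sector : HasJacobian sector fun b => |b.1| / √(1 - b.2 ^ 2) := by
  have hslope := HasJacobian.prodMk_left
    (T := fun a s : ℝ => |a| * (s / √(1 - s ^ 2)) + 0)
    (J := fun a s => (√(1 - s ^ 2) ^ 3)⁻¹ * |(|a|)|)
    (by unfold Function.uncurry; fun_prop) (by unfold Function.uncurry; fun_prop)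
    (fun _ _ => by positivity)
    (ae_ne_zero.mono fun a ha =>
      (hasJacobian_affine (abs_ne_zero.2 ha) 0).comp hasJacobian_div_sqrt_one_sub_sq)
  have hm : Measurable sector := by unfold sector; fun_prop
  refine .of_lintegral hm (by fun_prop) (fun _ => by positivity) fun F hF => ?_
  have := hslope.measurable
  have := hslope.measurable_jacobian
  rw [hslope.lintegral_eq hF, Measure.volume_eq_prod, lintegral_prod_symm _ (by fun_prop),
    lintegral_prod_symm _ (by fun_prop)]
  refine lintegral_congr fun s => ?_
  by_cases hs : s ∈ Set.Ioo (-1 : ℝ) 1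
  · have hpos := sqrt_one_sub_sq_pos hs
    rw [(hasJacobian_affine hpos.ne' 0).lintegral_eq (by fun_prop)]
    refine lintegral_congr fun l => ?_
    rw [← mul_assoc, ← ENNReal.ofReal_mul (by positivity), add_zero, abs_abs, abs_mul,
      abs_of_pos hpos, sector]
    congr 2
    · field_simp
    · refine Prod.ext (mul_comm _ _) ?_
      simp only [add_zero]
      field_simp
  · simp [sqrt_one_sub_sq_eq_zero hs]

/-- The pair `(p, q)` of plane vectors where `q` has the coordinates `sector (l, s)` relative
to `p`, for `c = ((p, l), s)`. -/
def rotPair (c : ((ℝ × ℝ) × ℝ) × ℝ) : (ℝ × ℝ) × (ℝ × ℝ) :=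
  (c.1.1, inFrame c.1.1 (sector (c.1.2, c.2)))

/-- The Jacobian of `rotPair`. -/
def rotJacobian (c : ((ℝ × ℝ) × ℝ) × ℝ) : ℝ := |c.1.2| / √(1 - c.2 ^ 2) * normSq c.1.1

@[fun_prop]
theorem continuous_rotPair : Continuous rotPair := by
  unfold rotPair inFrame sector; fun_prop

@[fun_prop]
theorem measurable_rotJacobian : Measurable rotJacobian := by
  have := continuous_normSq.measurable
  unfold rotJacobian
  fun_prop

theorem hasJacobian_rotPair : HasJacobian rotPair rotJacobian := by
  have hassoc : HasJacobian (MeasurableEquiv.prodAssoc : ((ℝ × ℝ) × ℝ) × ℝ ≃ᵐ _) 1 :=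
    .of_measurePreserving volume_preserving_prodAssoc
  have hfib := HasJacobian.prodMk_left (X := ℝ × ℝ) (T := fun p b => inFrame p (sector b))
    (J := fun p b => |b.1| / √(1 - b.2 ^ 2) * normSq p)
    (by unfold Function.uncurry inFrame sector; fun_prop) ?_ ?_
    (ae_ne_zero.mono fun p hp => (hasJacobian_inFrame hp).comp hasJacobian_sector)
  · exact (hfib.comp hassoc).congr_ae continuous_rotPair.measurable measurable_rotJacobian
      (fun c => mul_nonneg (by positivity) (normSq_nonneg _)) (ae_of_all _ fun _ => rfl)
      (ae_of_all _ fun c => (one_mul (rotJacobian c)).symm)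
  · exact measurable_rotJacobian.comp (MeasurableEquiv.prodAssoc.symm.measurable)
  · exact fun p b => mul_nonneg (by positivity) (normSq_nonneg p)

/-! ### Regrouping of coordinates -/

/-- The indices of the variables as first and second members of pairs and a possible last
index. -/
def indexEquiv (n : ℕ) : (Fin (n / 2) ⊕ Fin (n / 2)) ⊕ Fin (n % 2) ≃ Fin n where
  toFun := Sum.elim (Sum.elim fstIdx sndIdx) fun j => ⟨n - 1, by have := j.2; omega⟩
  invFun k := if h : (k : ℕ) < 2 * (n / 2) then
      (if (k : ℕ) % 2 = 0 then .inl (.inl ⟨k / 2, by omega⟩) else .inl (.inr ⟨k / 2, by omega⟩))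
    else .inr ⟨0, by have := k.2; omega⟩
  left_inv := by
    rintro ((i | i) | j)
    · have := i.2
      simp [fstIdx, this]
    · have := i.2
      have h : 2 * (i : ℕ) + 1 < 2 * (n / 2) := by omega
      have h' : (2 * (i : ℕ) + 1) / 2 = i := by omega
      simp [sndIdx, h, h', Nat.add_mod]
    · have := j.2
      have h : ¬ (n - 1 < 2 * (n / 2)) := by omega
      refine (dif_neg h).trans (congrArg Sum.inr (Fin.ext ?_))
      simp only
      omega
  right_inv k := by
    have := k.2
    simp only
    split_ifs with h h' <;> simp only [Sum.elim_inl, Sum.elim_inr, fstIdx, sndIdx, Fin.ext_iff] <;>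
      omega

/-- The last index `n - 1`, indexed by a type that is empty for even `n`. -/
def oddIdx {n : ℕ} (j : Fin (n % 2)) : Fin n := indexEquiv n (.inr j)

/-- The parameters of the pairs and of a possible last variable. -/
def paramEquiv (n : ℕ) : Fin (n / 2) ⊕ Fin (n % 2) ≃ Fin ((n + 1) / 2) where
  toFun := Sum.elim (fun i => ⟨i, by omega⟩) fun j => ⟨n / 2, by have := j.2; omega⟩
  invFun k := if h : (k : ℕ) < n / 2 then .inl ⟨k, h⟩ else .inr ⟨0, by have := k.2; omega⟩
  left_inv := by
    rintro (i | j)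
    · simp
    · have := j.2
      refine (dif_neg (lt_irrefl _)).trans (congrArg Sum.inr (Fin.ext ?_))
      simp only
      omega
  right_inv k := by
    have := k.2
    simp only
    split_ifs with h <;> simp only [Sum.elim_inl, Sum.elim_inr, Fin.ext_iff]
    omega

theorem tildeCoupling_fstIdx {n : ℕ} (i : Fin (n / 2)) :
    tildeCoupling n (fstIdx i) = paramEquiv n (.inl i) := by
  simp [tildeCoupling, paramEquiv, fstIdx]

theorem tildeCoupling_sndIdx {n : ℕ} (i : Fin (n / 2)) :
    tildeCoupling n (sndIdx i) = paramEquiv n (.inl i) := by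
  simp only [tildeCoupling, paramEquiv, sndIdx, Equiv.coe_fn_mk, Sum.elim_inl, Fin.ext_iff]
  omega

theorem tildeCoupling_oddIdx {n : ℕ} (j : Fin (n % 2)) :
    tildeCoupling n (oddIdx j) = paramEquiv n (.inr j) := by
  have := j.2
  simp only [tildeCoupling, oddIdx, indexEquiv, paramEquiv, Equiv.coe_fn_mk, Sum.elim_inr,
    Fin.ext_iff]
  omega

theorem forall_index_iff {n : ℕ} {p : Fin n → Prop} :
    (∀ k, p k) ↔ (∀ i, p (fstIdx i)) ∧ (∀ i, p (sndIdx i)) ∧ ∀ j, p (oddIdx j) := by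
  rw [← (indexEquiv n).forall_congr_right, Sum.forall, Sum.forall, and_assoc]
  rfl

theorem prod_index {n : ℕ} {M : Type*} [CommMonoid M] (g : Fin n → M) :
    ∏ k, g k = (∏ i, g (fstIdx i) * g (sndIdx i)) * ∏ j, g (oddIdx j) := by
  rw [← (indexEquiv n).prod_comp, Fintype.prod_sum_type, Fintype.prod_sum_type,
    Finset.prod_mul_distrib]
  rfl

section Glue

variable {ι ι' κ X : Type*} (e : ι ⊕ ι' ≃ κ)

/-- Two families joined into one along a splitting of the index type. -/
def glue (a : (ι → X) × (ι' → X)) (k : κ) : X := Sum.elim a.1 a.2 (e.symm k)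

@[simp]
theorem glue_inl (a : (ι → X) × (ι' → X)) (i : ι) : glue e a (e (.inl i)) = a.1 i := by
  simp [glue]

@[simp]
theorem glue_inr (a : (ι → X) × (ι' → X)) (i : ι') : glue e a (e (.inr i)) = a.2 i := by
  simp [glue]

theorem measurePreserving_glue [Fintype ι] [Fintype ι'] [Fintype κ] [MeasureSpace X]
    [SigmaFinite (volume : Measure X)] : MeasurePreserving (glue (X := X) e) := by
  have h : glue (X := X) e = MeasurableEquiv.piCongrLeft (fun _ => X) e ∘
      (MeasurableEquiv.sumPiEquivProdPi fun _ : ι ⊕ ι' => X).symm := by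
    funext a k
    obtain ⟨k, rfl⟩ := e.surjective k
    rw [Function.comp_apply, MeasurableEquiv.coe_piCongrLeft, Equiv.piCongrLeft_apply_apply]
    rcases k with k | k
    · exact glue_inl e a k
    · exact glue_inr e a k
  rw [h]
  exact (volume_measurePreserving_piCongrLeft (fun _ => X) e).comp
    (volume_measurePreserving_sumPiEquivProdPi_symm fun _ : ι ⊕ ι' => X)

end Glue

section Regroup

variable {X : Type*} {n : ℕ}

/-- The family with pairs of members `(a.1 i).1`, `(a.1 i).2` and possible last member `a.2 j`. -/
def regroup (n : ℕ) (a : (Fin (n / 2) → X × X) × (Fin (n % 2) → X)) : Fin n → X :=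
  glue (indexEquiv n) (Sum.elim (fun i => (a.1 i).1) fun i => (a.1 i).2, a.2)

variable (a : (Fin (n / 2) → X × X) × (Fin (n % 2) → X))

@[simp]
theorem regroup_fstIdx (i : Fin (n / 2)) : regroup n a (fstIdx i) = (a.1 i).1 :=
  glue_inl (indexEquiv n) _ (.inl i)

@[simp]
theorem regroup_sndIdx (i : Fin (n / 2)) : regroup n a (sndIdx i) = (a.1 i).2 :=
  glue_inl (indexEquiv n) _ (.inr i)

@[simp]
theorem regroup_oddIdx (j : Fin (n % 2)) : regroup n a (oddIdx j) = a.2 j :=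
  glue_inr (indexEquiv n) _ j

theorem measurePreserving_regroup [MeasureSpace X] [SigmaFinite (volume : Measure X)] :
    MeasurePreserving (regroup (X := X) n) := by
  have h : regroup (X := X) n = glue (indexEquiv n) ∘ Prod.map (glue (Equiv.refl _) ∘
      MeasurableEquiv.arrowProdEquivProdArrow X X (Fin (n / 2))) id := rfl
  rw [h]
  exact (measurePreserving_glue (indexEquiv n)).comp <|
    ((measurePreserving_glue (Equiv.refl _)).comp
      (volume_measurePreserving_arrowProdEquivProdArrow X X (Fin (n / 2)))).prod (.id volume)

end Regroup

theorem measurePreserving_prodProdProdComm (A B C D : Type*) [MeasureSpace A] [MeasureSpace B]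
    [MeasureSpace C] [MeasureSpace D] [SFinite (volume : Measure A)] [SFinite (volume : Measure B)]
    [SFinite (volume : Measure C)] [SFinite (volume : Measure D)] :
    MeasurePreserving fun a : (A × B) × (C × D) => ((a.1.1, a.2.1), (a.1.2, a.2.2)) := by
  have hswap : MeasurePreserving fun b : B × (C × D) => (b.2.1, (b.1, b.2.2)) :=
    volume_preserving_prodAssoc.comp <|
      (Measure.measurePreserving_swap.prod (.id volume)).comp <|
        volume_preserving_prodAssoc.symm MeasurableEquiv.prodAssoc
  exact (volume_preserving_prodAssoc.symm MeasurableEquiv.prodAssoc).comp <|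
    ((MeasurePreserving.id (volume : Measure A)).prod hswap).comp volume_preserving_prodAssoc

/-! ### Rays and kernels -/

/-- The point `(x_k, u_k)`. -/
def coord {n : ℕ} (w : Phase n) (k : Fin n) : ℝ × ℝ := (w.1 k, w.2 k)

theorem ext_coord {n : ℕ} {w w' : Phase n} (h : coord w = coord w') : w = w' :=
  Prod.ext (funext fun k => congrArg Prod.fst (congrFun h k))
    (funext fun k => congrArg Prod.snd (congrFun h k))

/-- The point of phase space with pairs of coordinates `a.1 i` and possible last coordinates
`a.2 j`. -/
def phaseOf (n : ℕ) (a : (Fin (n / 2) → (ℝ × ℝ) × (ℝ × ℝ)) × (Fin (n % 2) → ℝ × ℝ)) : Phase n :=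
  (fun k => (regroup n a k).1, fun k => (regroup n a k).2)

theorem coord_phaseOf {n : ℕ}
    (a : (Fin (n / 2) → (ℝ × ℝ) × (ℝ × ℝ)) × (Fin (n % 2) → ℝ × ℝ)) :
    coord (phaseOf n a) = regroup n a := rfl

theorem measurePreserving_phaseOf (n : ℕ) : MeasurePreserving (phaseOf n) :=
  (volume_measurePreserving_arrowProdEquivProdArrow ℝ ℝ (Fin n)).comp measurePreserving_regroup

/-- The parameters and variables with values `a.1 i` for the pairs, which share the parameter
`(a.1 i).1`, and `a.2 j` for a possible last variable. -/
def raysOf (n : ℕ) (a : (Fin (n / 2) → ℝ × (ℝ × ℝ)) × (Fin (n % 2) → ℝ × ℝ)) :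
    (Fin ((n + 1) / 2) → ℝ) × (Fin n → ℝ) :=
  (glue (paramEquiv n) (fun i => (a.1 i).1, fun j => (a.2 j).1),
    regroup n (fun i => (a.1 i).2, fun j => (a.2 j).2))

theorem measurePreserving_raysOf (n : ℕ) : MeasurePreserving (raysOf n) :=
  ((measurePreserving_glue (paramEquiv n)).prod measurePreserving_regroup).comp <|
    (measurePreserving_prodProdProdComm _ _ _ _).comp <|
      (volume_measurePreserving_arrowProdEquivProdArrow ℝ (ℝ × ℝ) (Fin (n / 2))).prod
        (volume_measurePreserving_arrowProdEquivProdArrow ℝ ℝ (Fin (n % 2)))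

section Rays

variable {n : ℕ} {ι : Type*}

/-- The point `(((1 - 1 / α_{c k}) v_k)_k, v)`, for `a = (α, v)`. -/
def rays (c : Fin n → ι) (a : (ι → ℝ) × (Fin n → ℝ)) : Phase n :=
  (fun k => (1 - 1 / a.1 (c k)) * a.2 k, a.2)

theorem coord_rays (c : Fin n → ι) (a : (ι → ℝ) × (Fin n → ℝ)) (k : Fin n) :
    coord (rays c a) k = rayPoint (a.1 (c k), a.2 k) := rfl

@[fun_prop]
theorem measurable_rays (c : Fin n → ι) : Measurable (rays c) := by unfold rays; fun_prop

/-- `∏ₖ |α_{c k}|⁻¹`. -/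
def couplingDensity (c : Fin n → ι) (α : ι → ℝ) : ℝ≥0∞ := ∏ k, (ENNReal.ofReal |α (c k)|)⁻¹

@[fun_prop]
theorem measurable_couplingDensity (c : Fin n → ι) : Measurable (couplingDensity c) := by
  unfold couplingDensity
  fun_prop

/-- The measure `∏ₖ |α_{c k}|⁻¹ dα dv`. -/
def rayMeasure [Fintype ι] (c : Fin n → ι) : Measure ((ι → ℝ) × (Fin n → ℝ)) :=
  volume.withDensity fun a => couplingDensity c a.1

end Rays

/-- The density `|x - u|⁻¹` on `ℝ × ℝ`. -/
def diagDensity (p : ℝ × ℝ) : ℝ≥0∞ := (ENNReal.ofReal |p.1 - p.2|)⁻¹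

@[fun_prop]
theorem measurable_diagDensity : Measurable diagDensity := by unfold diagDensity; fun_prop

theorem ofReal_jacobian_mul_diagDensity_rayPoint {a : ℝ × ℝ} (hα : a.1 ≠ 0) (hv : a.2 ≠ 0) :
    ENNReal.ofReal ((a.1 ^ 2)⁻¹ * |a.2|) * diagDensity (rayPoint a) =
      (ENNReal.ofReal |a.1|)⁻¹ := by
  have hdiag : |(rayPoint a).1 - (rayPoint a).2| = |a.2| / |a.1| := by
    rw [← abs_div, ← abs_neg]
    congr 1
    simp only [rayPoint]
    ring
  have hα' := abs_pos.2 hα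
  have := abs_pos.2 hv
  rw [diagDensity, hdiag, ← ENNReal.ofReal_inv_of_pos (by positivity), ← ENNReal.ofReal_mul
    (by positivity), ← ENNReal.ofReal_inv_of_pos hα', ← sq_abs a.1]
  congr 1
  field_simp

theorem ae_pi_ne_zero {ι : Type*} [Fintype ι] : ∀ᵐ α : ι → ℝ, ∀ i, α i ≠ 0 :=
  ae_all_iff.2 fun i => Measure.ae_eval_ne (fun _ => volume) i 0

theorem ae_forall_ne_zero {ι κ : Type*} [Fintype ι] [Fintype κ] :
    ∀ᵐ a : (ι → ℝ) × (κ → ℝ), (∀ i, a.1 i ≠ 0) ∧ ∀ k, a.2 k ≠ 0 :=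
  (Measure.quasiMeasurePreserving_fst.ae ae_pi_ne_zero).and
    (Measure.quasiMeasurePreserving_snd.ae ae_pi_ne_zero)

theorem measurePreserving_rays_bar (n : ℕ) :
    MeasurePreserving (rays (barCoupling n)) (rayMeasure (barCoupling n)) (barKernel n) := by
  have hG := volume_measurePreserving_arrowProdEquivProdArrow ℝ ℝ (Fin n)
  have hJ := ((HasJacobian.of_measurePreserving hG).comp
    (.piMap fun _ : Fin n => hasJacobian_rayPoint)).comp (.of_measurePreserving hG.symm)
  have hd : Measurable fun w : Phase n => ∏ k, diagDensity (coord w k) := by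
    unfold coord
    fun_prop
  have h := hJ.measurePreserving_withDensity hd
  rw [withDensity_congr_ae (g := fun a => couplingDensity (barCoupling n) a.1)] at h
  · exact h
  filter_upwards [ae_forall_ne_zero] with a ha
  simp only [Pi.one_apply, mul_one, one_mul]
  rw [ENNReal.ofReal_prod_of_nonneg fun _ _ => by positivity, ← Finset.prod_mul_distrib]
  exact Finset.prod_congr rfl fun k _ =>
    ofReal_jacobian_mul_diagDensity_rayPoint (ha.1 k) (ha.2 k)

/-- The parameter space of the phase space points whose pairs of coordinates are proportional:
`(p, λ)` stands for the pair `(p, λ p)`. -/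
abbrev PropPairs (n : ℕ) : Type := (Fin (n / 2) → (ℝ × ℝ) × ℝ) × (Fin (n % 2) → ℝ × ℝ)

/-- The phase space point with parameters `b`. -/
def propPhase (n : ℕ) (b : PropPairs n) : Phase n := phaseOf n (fun i => propPair (b.1 i), b.2)

@[fun_prop]
theorem measurable_propPhase (n : ℕ) : Measurable (propPhase n) := by
  have : Measurable propPair := by unfold propPair; fun_prop
  exact (measurePreserving_phaseOf n).measurable.comp (by fun_prop)

/-- `∏ⱼ |x_j - u_j|⁻¹` over the at most one unpaired index. -/
def oddDensity {n : ℕ} (q : Fin (n % 2) → ℝ × ℝ) : ℝ≥0∞ := ∏ j, diagDensity (q j)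

/-- The kernel of `P̃* P̃`: Lebesgue measure `dp dλ` on proportional pairs, times `|x - u|⁻¹ dx du`
for a possible unpaired variable. -/
def tildeKernel (n : ℕ) : Measure (Phase n) :=
  (volume.withDensity fun b : PropPairs n => oddDensity b.2).map (propPhase n)

theorem rays_raysOf {n : ℕ} {a : (Fin (n / 2) → ℝ × (ℝ × ℝ)) × (Fin (n % 2) → ℝ × ℝ)}
    (ha : ∀ i, (a.1 i).2.1 ≠ 0) :
    rays (tildeCoupling n) (raysOf n a) =
      propPhase n (Prod.map (Pi.map fun _ => rayLine) (Pi.map fun _ => rayPoint) a) := by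
  refine ext_coord (funext (forall_index_iff.2 ⟨fun i => ?_, fun i => ?_, fun j => ?_⟩))
  · simp [coord_rays, propPhase, coord_phaseOf, tildeCoupling_fstIdx, raysOf, propPair_rayLine, ha]
  · simp [coord_rays, propPhase, coord_phaseOf, tildeCoupling_sndIdx, raysOf, propPair_rayLine, ha]
  · simp [coord_rays, propPhase, coord_phaseOf, tildeCoupling_oddIdx, raysOf]

theorem couplingDensity_raysOf {n : ℕ} {a : (Fin (n / 2) → ℝ × (ℝ × ℝ)) × (Fin (n % 2) → ℝ × ℝ)}
    (hα : ∀ i, (raysOf n a).1 i ≠ 0) (hv : ∀ k, (raysOf n a).2 k ≠ 0) :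
    couplingDensity (tildeCoupling n) (raysOf n a).1 =
      ENNReal.ofReal ((∏ i, ((a.1 i).1 ^ 2)⁻¹) * ∏ j, ((a.2 j).1 ^ 2)⁻¹ * |(a.2 j).2|) *
        oddDensity (Pi.map (fun _ => rayPoint) a.2) := by
  rw [ENNReal.ofReal_mul (Finset.prod_nonneg fun _ _ => by positivity),
    ENNReal.ofReal_prod_of_nonneg fun _ _ => by positivity,
    ENNReal.ofReal_prod_of_nonneg fun _ _ => by positivity, mul_assoc, oddDensity,
    ← Finset.prod_mul_distrib, couplingDensity, prod_index]
  congr 1 <;> refine Finset.prod_congr rfl fun i _ => ?_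
  · have hα' : (a.1 i).1 ≠ 0 := by simpa [raysOf] using hα (paramEquiv n (.inl i))
    rw [← sq_abs, ENNReal.ofReal_inv_of_pos (by positivity), ENNReal.ofReal_pow (abs_nonneg _),
      ENNReal.inv_pow, sq]
    simp [raysOf, tildeCoupling_fstIdx, tildeCoupling_sndIdx]
  · refine (Eq.trans ?_ (ofReal_jacobian_mul_diagDensity_rayPoint ?_ ?_).symm)
    · simp [raysOf, tildeCoupling_oddIdx]
    · simpa [raysOf] using hα (paramEquiv n (.inr i))
    · simpa [raysOf] using hv (oddIdx i)

theorem measurePreserving_rays_tilde (n : ℕ) :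
    MeasurePreserving (rays (tildeCoupling n)) (rayMeasure (tildeCoupling n)) (tildeKernel n) := by
  have hH := measurePreserving_raysOf n
  have hne := hH.quasiMeasurePreserving.ae ae_forall_ne_zero
  have hd : Measurable fun b : PropPairs n => oddDensity b.2 := by unfold oddDensity; fun_prop
  have hJ : HasJacobian (Prod.map (Pi.map fun _ : Fin (n / 2) => rayLine)
      (Pi.map fun _ : Fin (n % 2) => rayPoint)) _ :=
    (HasJacobian.piMap fun _ => hasJacobian_rayLine).prodMap
      (HasJacobian.piMap fun _ => hasJacobian_rayPoint)
  have hray := (HasJacobian.of_measurePreserving hH).measurePreserving_withDensity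
    (d := fun a => couplingDensity (tildeCoupling n) a.1) (by fun_prop)
  have hline := hJ.measurePreserving_withDensity hd
  rw [← withDensity_congr_ae (g := _) (hne.mono fun a ha => by
    simpa using couplingDensity_raysOf ha.1 ha.2)] at hline
  refine ⟨by fun_prop, ?_⟩
  simp only [Pi.one_apply, ENNReal.ofReal_one, one_mul] at hray
  rw [rayMeasure, ← hray.map_eq, Measure.map_map (by fun_prop) hH.measurable, tildeKernel,
    ← hline.map_eq, Measure.map_map (by fun_prop) hline.measurable]
  exact Measure.map_congr (withDensity_absolutelyContinuous _ _ |>.ae_le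
    (hne.mono fun a ha => rays_raysOf fun i => by simpa [raysOf] using ha.2 (fstIdx i)))

/-! ### Generalized functions `δ(h)` in adapted coordinates -/

section DeltaCoordinates

variable {X Y κ : Type*} [TopologicalSpace X] [MeasureSpace X] [MeasureSpace Y] [Fintype κ]

/-- Coordinates `(y, s)` on `X` in which `h` is the projection to `s`, with a Jacobian that is
dominated locally uniformly in `s` near the slice `s = 0`. The equation `h = s` is only required
where the Jacobian does not vanish. -/
structure DeltaCoordinates (h : X → κ → ℝ) (Φ : Y × (κ → ℝ) → X) (J : Y × (κ → ℝ) → ℝ) :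
    Prop where
  measurable : Measurable h
  hasJacobian : HasJacobian Φ J
  apply_eq : ∀ a, J a ≠ 0 → h (Φ a) = a.2
  continuousAt : ∀ y, ContinuousAt (fun s => Φ (y, s)) 0
  continuousAt_jacobian : ∀ y, ContinuousAt (fun s => J (y, s)) 0
  exists_bound : ∀ K : Set X, IsCompact K → ∃ r > 0, ∃ g : Y → ℝ, Integrable g ∧
    ∀ y s, ‖s‖ ≤ r → Φ (y, s) ∈ K → J (y, s) ≤ g y

/-- The measure on the slice `s = 0` with density `J`. -/
def sliceMeasure (Φ : Y × (κ → ℝ) → X) (J : Y × (κ → ℝ) → ℝ) : Measure X :=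
  (volume.withDensity fun y => ENNReal.ofReal (J (y, 0))).map fun y => Φ (y, 0)

theorem hasJacobian_smul {c : ℝ} (hc : c ≠ 0) :
    HasJacobian (fun s : κ → ℝ => c • s) fun _ => |c| ^ Fintype.card κ := by
  convert HasJacobian.piMap fun _ : κ => hasJacobian_affine hc 0 using 1
  · funext s i
    exact (add_zero _).symm
  · simp

variable {h : X → κ → ℝ} {Φ : Y × (κ → ℝ) → X} {J : Y × (κ → ℝ) → ℝ}

namespace DeltaCoordinates

theorem isFiniteMeasureOnCompacts_sliceMeasure [T2Space X] [BorelSpace X]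
    (H : DeltaCoordinates h Φ J) : IsFiniteMeasureOnCompacts (sliceMeasure Φ J) := by
  refine ⟨fun K hK => ?_⟩
  obtain ⟨r, hr, g, hg, hJg⟩ := H.exists_bound K hK
  have hΦ : Measurable fun y => Φ (y, 0) := H.hasJacobian.measurable.comp measurable_prodMk_right
  rw [sliceMeasure, Measure.map_apply hΦ hK.measurableSet,
    withDensity_apply _ (hΦ hK.measurableSet)]
  calc ∫⁻ y in (fun y => Φ (y, 0)) ⁻¹' K, ENNReal.ofReal (J (y, 0))
      ≤ ∫⁻ y in (fun y => Φ (y, 0)) ⁻¹' K, ENNReal.ofReal (g y) :=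
        setLIntegral_mono' (hΦ hK.measurableSet) fun y hy =>
          ENNReal.ofReal_le_ofReal (hJg y 0 (by simpa using hr.le) hy)
    _ < ⊤ := hg.integrableOn.lintegral_lt_top

variable {ρ : ℝ → ℝ} {ψ : X → ℝ}

theorem integral_mollifier [SFinite (volume : Measure Y)] (H : DeltaCoordinates h Φ J)
    (hρ : Measurable ρ) (hψ : Measurable ψ) {ε : ℝ} (hε : 0 < ε) :
    ∫ w, (∏ i, ε⁻¹ * ρ (h w i / ε)) * ψ w =
      ∫ a : Y × (κ → ℝ), J (a.1, ε • a.2) * ψ (Φ (a.1, ε • a.2)) * ∏ i, ρ (a.2 i) := by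
  have hscale := H.hasJacobian.comp <|
    (HasJacobian.of_measurePreserving (.id (volume : Measure Y))).prodMap
      (hasJacobian_smul (κ := κ) hε.ne')
  have hm := H.measurable
  rw [hscale.integral_eq (by fun_prop)]
  refine integral_congr_ae (ae_of_all _ fun a => ?_)
  change (1 * |ε| ^ Fintype.card κ * J (a.1, ε • a.2)) *
    ((∏ i, ε⁻¹ * ρ (h (Φ (a.1, ε • a.2)) i / ε)) * ψ (Φ (a.1, ε • a.2))) = _
  by_cases hJ : J (a.1, ε • a.2) = 0
  · simp [hJ]
  · rw [H.apply_eq _ hJ, Finset.prod_mul_distrib, Finset.prod_const, Finset.card_univ,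
      abs_of_pos hε]
    simp only [Pi.smul_apply, smul_eq_mul, mul_div_cancel_left₀ _ hε.ne']
    rw [inv_pow]
    field_simp

theorem integral_sliceMeasure (H : DeltaCoordinates h Φ J) [SFinite (volume : Measure Y)]
    (hρ : IsMollifier ρ) (hψ : Measurable ψ) :
    ∫ w, ψ w ∂sliceMeasure Φ J =
      ∫ a : Y × (κ → ℝ), J (a.1, 0) * ψ (Φ (a.1, 0)) * ∏ i, ρ (a.2 i) := by
  have hΦ := H.hasJacobian.measurable
  have hJ := H.hasJacobian.measurable_jacobian
  rw [sliceMeasure, integral_map_withDensity_ofReal (by fun_prop) (by fun_prop)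
    (fun _ => H.hasJacobian.jacobian_nonneg _) hψ, Measure.volume_eq_prod,
    integral_prod_mul (fun y => J (y, 0) * ψ (Φ (y, 0))) fun s : κ → ℝ => ∏ i, ρ (s i),
    integral_fintype_prod_volume_eq_prod]
  simp [hρ.integral_eq_one]

theorem exists_integrable_bound (H : DeltaCoordinates h Φ J) [SFinite (volume : Measure Y)]
    (hρ : IsMollifier ρ) (hψ : Continuous ψ) (hψ' : HasCompactSupport ψ) :
    ∃ G : Y × (κ → ℝ) → ℝ, Integrable G ∧ ∀ᶠ ε : ℝ in 𝓝[>] 0, ∀ a,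
      ‖J (a.1, ε • a.2) * ψ (Φ (a.1, ε • a.2)) * ∏ i, ρ (a.2 i)‖ ≤ G a := by
  obtain ⟨r, hr, g, hg, hJg⟩ := H.exists_bound (tsupport ψ) hψ'
  obtain ⟨C, hC⟩ := hψ.bounded_above_of_compact_support hψ'
  obtain ⟨M, hM⟩ := hρ.compact.isCompact.isBounded.exists_norm_le
  refine ⟨fun a => |g a.1| * |C| * ∏ i, ρ (a.2 i), (hg.abs.mul_const _).mul_prod <|
    .fintype_prod fun _ => hρ.smooth.continuous.integrable_of_hasCompactSupport hρ.compact, ?_⟩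
  have hsmall : ∀ᶠ ε : ℝ in 𝓝[>] 0, |ε| * M < r :=
    (tendsto_nhdsWithin_of_tendsto_nhds
      (Continuous.tendsto' (by fun_prop) _ 0 (by simp))).eventually (gt_mem_nhds hr)
  filter_upwards [hsmall] with ε hε a
  have hρ0 : 0 ≤ ∏ i, ρ (a.2 i) := Finset.prod_nonneg fun i _ => hρ.nonneg _
  have hG0 : 0 ≤ |g a.1| * |C| * ∏ i, ρ (a.2 i) := by positivity
  by_cases hρa : ∏ i, ρ (a.2 i) = 0
  · simp [hρa]
  by_cases hψa : ψ (Φ (a.1, ε • a.2)) = 0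
  · rwa [hψa, mul_zero, zero_mul, norm_zero]
  have hs : ‖ε • a.2‖ ≤ r := (pi_norm_le_iff_of_nonneg hr.le).2 fun i => by
    rw [Pi.smul_apply, norm_smul]
    have := hM _ (subset_tsupport _ (Finset.prod_ne_zero_iff.1 hρa i (Finset.mem_univ i)))
    exact (mul_le_mul_of_nonneg_left this (norm_nonneg ε)).trans hε.le
  rw [norm_mul, norm_mul, Real.norm_of_nonneg hρ0,
    Real.norm_of_nonneg (H.hasJacobian.jacobian_nonneg _)]
  gcongr
  · exact (hJg _ _ hs (subset_tsupport _ hψa)).trans (le_abs_self _)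
  · exact (hC _).trans (le_abs_self C)

theorem isDelta [T2Space X] [BorelSpace X] [SFinite (volume : Measure Y)]
    (H : DeltaCoordinates h Φ J) : IsDelta h (sliceMeasure Φ J) := by
  refine ⟨H.isFiniteMeasureOnCompacts_sliceMeasure, fun ρ hρ ψ hψ hψ' => ?_⟩
  have hρm := hρ.smooth.continuous.measurable
  obtain ⟨G, hG, hbound⟩ := H.exists_integrable_bound hρ hψ hψ'
  rw [H.integral_sliceMeasure hρ hψ.measurable]
  refine (tendsto_integral_filter_of_dominated_convergence G (.of_forall fun ε => ?_)
    (hbound.mono fun ε h => ae_of_all _ h) hG (ae_of_all _ fun a => ?_)).congr'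
    (eventually_mem_nhdsWithin.mono fun ε hε =>
      (H.integral_mollifier hρm hψ.measurable hε).symm)
  · have hΦ := H.hasJacobian.measurable
    have hJ := H.hasJacobian.measurable_jacobian
    have := hψ.measurable
    exact Measurable.aestronglyMeasurable (by fun_prop)
  · have hs : Tendsto (fun ε : ℝ => ε • a.2) (𝓝[>] 0) (𝓝 0) :=
      tendsto_nhdsWithin_of_tendsto_nhds (Continuous.tendsto' (by fun_prop) _ _ (zero_smul ℝ _))
    exact (((H.continuousAt_jacobian a.1).tendsto.comp hs).mul
      ((hψ.tendsto _).comp ((H.continuousAt a.1).tendsto.comp hs))).mul_const _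

end DeltaCoordinates

end DeltaCoordinates

/-! ### The kernel `∏ᵢ δ(sin (φ_i - ϕ_i))` -/

theorem sin_angle_sub_angle (p q : ℝ × ℝ) :
    Real.sin (angle p.1 p.2 - angle q.1 q.2) =
      Real.sin (Complex.arg ⟨p.1, p.2⟩ - Complex.arg ⟨q.1, q.2⟩) := by
  simp only [angle, toIcoMod, zsmul_eq_mul]
  rw [sub_sub_sub_comm, ← sub_mul, ← Int.cast_sub, Real.sin_sub_int_mul_two_pi]

theorem sin_arg_sub_arg {p q : ℝ × ℝ} (hp : p ≠ 0) (hq : q ≠ 0) :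
    Real.sin (Complex.arg ⟨p.1, p.2⟩ - Complex.arg ⟨q.1, q.2⟩) =
      (p.2 * q.1 - p.1 * q.2) / (√(normSq p) * √(normSq q)) := by
  have hne (p : ℝ × ℝ) (hp : p ≠ 0) : (⟨p.1, p.2⟩ : ℂ) ≠ 0 := fun h =>
    hp (Prod.ext (congrArg Complex.re h) (congrArg Complex.im h))
  have hnorm (p : ℝ × ℝ) : ‖(⟨p.1, p.2⟩ : ℂ)‖ = √(normSq p) := by
    rw [Complex.norm_def, Complex.normSq_mk, normSq, sq, sq]
  have hp' := Real.sqrt_pos.2 (normSq_pos hp)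
  have hq' := Real.sqrt_pos.2 (normSq_pos hq)
  rw [Real.sin_sub, Complex.sin_arg, Complex.sin_arg, Complex.cos_arg (hne p hp),
    Complex.cos_arg (hne q hq), hnorm, hnorm]
  field_simp

theorem normSq_inFrame (p y : ℝ × ℝ) : normSq (inFrame p y) = normSq y * normSq p := by
  simp only [normSq, inFrame, Prod.fst_add, Prod.snd_add, Prod.smul_fst, Prod.smul_snd,
    smul_eq_mul]
  ring

theorem normSq_sector {b : ℝ × ℝ} (h : b.2 ^ 2 ≤ 1) : normSq (sector b) = b.1 ^ 2 := by
  rw [normSq, sector, mul_pow, mul_pow, Real.sq_sqrt (sub_nonneg.2 h), sq_abs]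
  ring

theorem rotJacobian_ne_zero_iff {c : ((ℝ × ℝ) × ℝ) × ℝ} :
    rotJacobian c ≠ 0 ↔ c.1.2 ≠ 0 ∧ c.2 ^ 2 < 1 ∧ c.1.1 ≠ 0 := by
  have hN : normSq c.1.1 ≠ 0 ↔ c.1.1 ≠ 0 :=
    ⟨fun h h0 => h (by simp [h0, normSq]), fun h => (normSq_pos h).ne'⟩
  rw [rotJacobian, mul_ne_zero_iff, div_ne_zero_iff, abs_ne_zero, Real.sqrt_ne_zero', sub_pos, hN,
    and_assoc]

theorem sin_angle_rotPair {c : ((ℝ × ℝ) × ℝ) × ℝ} (h : rotJacobian c ≠ 0) :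
    Real.sin (angle (rotPair c).1.1 (rotPair c).1.2 - angle (rotPair c).2.1 (rotPair c).2.2) =
      c.2 := by
  obtain ⟨hl, hs, hp⟩ := rotJacobian_ne_zero_iff.1 h
  have hp' := normSq_pos hp
  have hq : normSq (rotPair c).2 = c.1.2 ^ 2 * normSq c.1.1 := by
    rw [rotPair, normSq_inFrame, normSq_sector hs.le]
  have hq0 : (rotPair c).2 ≠ 0 := fun h0 => by
    have : normSq (rotPair c).2 ≠ 0 := by rw [hq]; positivity
    exact this (by simp [h0, normSq])
  rw [sin_angle_sub_angle, sin_arg_sub_arg (by exact hp) hq0, hq, Real.sqrt_mul (sq_nonneg _),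
    Real.sqrt_sq_eq_abs, mul_left_comm, show (rotPair c).1 = c.1.1 from rfl,
    Real.mul_self_sqrt hp'.le, div_eq_iff (by positivity)]
  simp only [rotPair, inFrame, sector, Prod.fst_add, Prod.snd_add, Prod.smul_fst, Prod.smul_snd,
    smul_eq_mul, normSq]
  ring

theorem sq_norm_le_normSq (p : ℝ × ℝ) : ‖p‖ ^ 2 ≤ normSq p := by
  rcases max_choice ‖p.1‖ ‖p.2‖ with h | h <;>
    rw [Prod.norm_def, h, Real.norm_eq_abs, sq_abs, normSq]
  · exact le_add_of_nonneg_right (sq_nonneg _)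
  · exact le_add_of_nonneg_left (sq_nonneg _)

theorem normSq_le_two_mul_sq_norm (p : ℝ × ℝ) : normSq p ≤ 2 * ‖p‖ ^ 2 := by
  have h₁ : p.1 ^ 2 ≤ ‖p‖ ^ 2 := sq_le_sq.2 (by simpa using norm_fst_le p)
  have h₂ : p.2 ^ 2 ≤ ‖p‖ ^ 2 := sq_le_sq.2 (by simpa using norm_snd_le p)
  rw [normSq]
  linarith

/-- A locally uniform majorant of `rotJacobian (b, s)` for `|s| ≤ 1 / 2` on the set of all `b`
for which `rotPair (b, s)` lies in the ball of radius `R`. -/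
def rotBound (R : ℝ) (b : (ℝ × ℝ) × ℝ) : ℝ :=
  ‖b.1‖ * (Metric.closedBall (0 : ℝ × ℝ) R ×ˢ Metric.closedBall (0 : ℝ) (2 * R)).indicator
    (fun _ => 8 * R) (b.1, ‖b.1‖ * b.2)

theorem rotJacobian_le_rotBound {R s : ℝ} {b : (ℝ × ℝ) × ℝ} (hs : |s| ≤ 1 / 2)
    (hR : ‖rotPair (b, s)‖ ≤ R) : rotJacobian (b, s) ≤ rotBound R b := by
  have hs' : s ^ 2 ≤ 1 / 4 := by rw [← sq_abs]; nlinarith [abs_nonneg s]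
  have hp : ‖b.1‖ ≤ R := (norm_fst_le (rotPair (b, s))).trans hR
  have hR0 : 0 ≤ R := (norm_nonneg _).trans hp
  have hl : ‖b.1‖ * |b.2| ≤ 2 * R := by
    refine abs_le_of_sq_le_sq' ?_ (by positivity) |>.2
    calc (‖b.1‖ * |b.2|) ^ 2 = b.2 ^ 2 * ‖b.1‖ ^ 2 := by rw [mul_pow, sq_abs, mul_comm]
      _ ≤ b.2 ^ 2 * normSq b.1 := by gcongr; exact sq_norm_le_normSq _
      _ = normSq (rotPair (b, s)).2 := by
        rw [rotPair, normSq_inFrame, normSq_sector (by dsimp only; linarith)]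
      _ ≤ 2 * ‖(rotPair (b, s)).2‖ ^ 2 := normSq_le_two_mul_sq_norm _
      _ ≤ 2 * R ^ 2 := by gcongr; exact (norm_snd_le _).trans hR
      _ ≤ (2 * R) ^ 2 := by nlinarith
  have hmem : (b.1, ‖b.1‖ * b.2) ∈
      Metric.closedBall (0 : ℝ × ℝ) R ×ˢ Metric.closedBall (0 : ℝ) (2 * R) :=
    ⟨mem_closedBall_zero_iff.2 hp, mem_closedBall_zero_iff.2 (by simpa using hl)⟩
  have hsqrt : 1 / 2 ≤ √(1 - s ^ 2) := Real.le_sqrt_of_sq_le (by linarith)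
  rw [rotBound, Set.indicator_of_mem hmem, rotJacobian]
  calc |b.2| / √(1 - s ^ 2) * normSq b.1
      ≤ |b.2| / (1 / 2) * (2 * ‖b.1‖ ^ 2) := by
        gcongr
        exacts [normSq_nonneg _, normSq_le_two_mul_sq_norm _]
    _ = ‖b.1‖ * (4 * (‖b.1‖ * |b.2|)) := by ring
    _ ≤ ‖b.1‖ * (8 * R) := mul_le_mul_of_nonneg_left (by linarith) (norm_nonneg _)

theorem integrable_rotBound (R : ℝ) : Integrable (rotBound R) := by
  have hscale := HasJacobian.prodMk_left (T := fun (p : ℝ × ℝ) l => ‖p‖ * l + 0)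
    (J := fun p _ => |‖p‖|) (by unfold Function.uncurry; fun_prop)
    (by unfold Function.uncurry; fun_prop) (fun _ _ => abs_nonneg _)
    (ae_ne_zero.mono fun p hp => hasJacobian_affine (norm_ne_zero_iff.2 hp) 0)
  simp only [abs_norm, add_zero] at hscale
  refine hscale.integrable_mul_comp (IntegrableOn.integrable_indicator ?_ ?_)
  · exact integrableOn_const (((isCompact_closedBall _ _).prod
      (isCompact_closedBall _ _)).measure_lt_top.ne)
  · exact measurableSet_closedBall.prod measurableSet_closedBall

section

variable {n : ℕ}

@[fun_prop]
theorem measurable_sinDiff (n : ℕ) : Measurable (sinDiff n) := by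
  have harg (k : Fin n) : Measurable fun w : Phase n => Complex.arg ⟨w.1 k, w.2 k⟩ :=
    Complex.measurable_arg.comp <| Complex.measurableEquivRealProd.symm.measurable.comp
      (f := fun w : Phase n => (w.1 k, w.2 k)) (by fun_prop)
  refine measurable_pi_lambda _ fun i => ?_
  simp only [sinDiff, sin_angle_sub_angle (_, _) (_, _)]
  exact Real.measurable_sin.comp ((harg _).sub (harg _))

theorem sinDiff_eq (w : Phase n) (i : Fin (n / 2)) :
    sinDiff n w i = Real.sin (angle (coord w (fstIdx i)).1 (coord w (fstIdx i)).2 -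
      angle (coord w (sndIdx i)).1 (coord w (sndIdx i)).2) := rfl

/-- Coordinates on phase space in which `sinDiff` is the projection to `a.2`. -/
def rotPhase (n : ℕ) (a : PropPairs n × (Fin (n / 2) → ℝ)) : Phase n :=
  phaseOf n (fun i => rotPair (a.1.1 i, a.2 i), a.1.2)

/-- The Jacobian of `rotPhase`. It vanishes unless all `|a.2 i| < 1`, by the conventions `√x = 0`
for `x ≤ 0` and `x / 0 = 0` in `rotJacobian`. -/
def rotPhaseJacobian (n : ℕ) (a : PropPairs n × (Fin (n / 2) → ℝ)) : ℝ :=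
  ∏ i, rotJacobian (a.1.1 i, a.2 i)

theorem hasJacobian_rotPhase (n : ℕ) : HasJacobian (rotPhase n) (rotPhaseJacobian n) := by
  have hcomm : MeasurePreserving fun a : PropPairs n × (Fin (n / 2) → ℝ) =>
      (fun i => (a.1.1 i, a.2 i), a.1.2) :=
    ((volume_measurePreserving_arrowProdEquivProdArrow _ ℝ (Fin (n / 2))).symm.prod
      (.id volume)).comp <|
    (volume_preserving_prodAssoc.symm MeasurableEquiv.prodAssoc).comp <|
      ((MeasurePreserving.id volume).prod Measure.measurePreserving_swap).comp
        volume_preserving_prodAssoc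
  have hrot := (HasJacobian.piMap fun _ : Fin (n / 2) => hasJacobian_rotPair).prodMap
    (.of_measurePreserving (.id (volume : Measure (Fin (n % 2) → ℝ × ℝ))))
  convert (HasJacobian.of_measurePreserving (measurePreserving_phaseOf n)).comp
    (hrot.comp (.of_measurePreserving hcomm)) using 1
  · rfl
  · funext a
    simp [rotPhaseJacobian]

theorem continuous_phaseOf (n : ℕ) : Continuous (phaseOf n) := by
  have h (k : Fin n) : Continuous fun a => regroup (X := ℝ × ℝ) n a k := by
    revert k
    refine forall_index_iff.2 ⟨fun i => ?_, fun i => ?_, fun j => ?_⟩ <;>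
      simp only [regroup_fstIdx, regroup_sndIdx, regroup_oddIdx] <;> fun_prop
  exact (continuous_pi fun k => (h k).fst).prodMk (continuous_pi fun k => (h k).snd)

theorem norm_coord_le (w : Phase n) (k : Fin n) : ‖coord w k‖ ≤ ‖w‖ :=
  max_le ((norm_le_pi_norm _ k).trans (norm_fst_le w)) ((norm_le_pi_norm _ k).trans (norm_snd_le w))

theorem continuousAt_rotJacobian (b : (ℝ × ℝ) × ℝ) :
    ContinuousAt (fun s => rotJacobian (b, s)) 0 :=
  (ContinuousAt.div (by fun_prop) (by fun_prop) (by simp)).mul continuousAt_const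

theorem deltaCoordinates_rotPhase (n : ℕ) :
    DeltaCoordinates (sinDiff n) (rotPhase n) (rotPhaseJacobian n) where
  measurable := measurable_sinDiff n
  hasJacobian := hasJacobian_rotPhase n
  apply_eq a ha := funext fun i => by
    simpa [sinDiff_eq, rotPhase, coord_phaseOf] using
      sin_angle_rotPair (Finset.prod_ne_zero_iff.1 ha i (Finset.mem_univ i))
  continuousAt b := ((continuous_phaseOf n).comp (by fun_prop)).continuousAt
  continuousAt_jacobian b := tendsto_finsetProd _ fun i _ =>
    (continuousAt_rotJacobian (b.1 i)).tendsto.comp ((continuous_apply i).tendsto 0)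
  exists_bound K hK := by
    obtain ⟨R, hR⟩ := hK.isBounded.exists_norm_le
    refine ⟨1 / 2, by norm_num, fun b => (∏ i, rotBound R (b.1 i)) *
      (Metric.closedBall (0 : Fin (n % 2) → ℝ × ℝ) R).indicator 1 b.2,
      (Integrable.fintype_prod fun _ => integrable_rotBound R).mul_prod
        (IntegrableOn.integrable_indicator (integrableOn_const
          (isCompact_closedBall _ _).measure_lt_top.ne) measurableSet_closedBall),
      fun b s hs hK => ?_⟩
    have hcoord (k : Fin n) : ‖regroup n (fun i => rotPair (b.1 i, s i), b.2) k‖ ≤ R :=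
      (norm_coord_le (rotPhase n (b, s)) k).trans (hR _ hK)
    obtain ⟨hfst, hsnd, hodd⟩ := forall_index_iff.1 hcoord
    simp only [regroup_fstIdx, regroup_sndIdx, regroup_oddIdx] at hfst hsnd hodd
    have hb : b.2 ∈ Metric.closedBall 0 R := mem_closedBall_zero_iff.2 <|
      (pi_norm_le_iff_of_nonneg ((norm_nonneg _).trans (hR _ hK))).2 hodd
    beta_reduce
    rw [Set.indicator_of_mem hb, Pi.one_apply, mul_one]
    exact Finset.prod_le_prod (fun i _ => hasJacobian_rotPair.jacobian_nonneg _) fun i _ =>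
      rotJacobian_le_rotBound ((norm_le_pi_norm s i).trans hs) (max_le (hfst i) (hsnd i))

theorem sliceMeasure_withDensity {X Y κ : Type*} [MeasureSpace X] [MeasureSpace Y]
    {Φ : Y × (κ → ℝ) → X} {J : Y × (κ → ℝ) → ℝ} (hΦ : Measurable Φ) (hJ : Measurable J)
    {d : X → ℝ≥0∞} (hd : Measurable d) :
    (sliceMeasure Φ J).withDensity d =
      (volume.withDensity fun y => ENNReal.ofReal (J (y, 0)) * d (Φ (y, 0))).map
        fun y => Φ (y, 0) := by
  refine Measure.ext_of_lintegral _ fun F hF => ?_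
  rw [lintegral_withDensity_eq_lintegral_mul _ hd hF, sliceMeasure,
    lintegral_map_withDensity (by fun_prop) (by fun_prop) (by fun_prop),
    lintegral_map_withDensity (by fun_prop) (by fun_prop) hF]
  simp only [Pi.mul_apply, mul_assoc]

theorem rotPair_zero (b : (ℝ × ℝ) × ℝ) : rotPair (b, 0) = propPair b := by
  simp [rotPair, propPair, inFrame, sector]

theorem rotPhase_zero (b : PropPairs n) : rotPhase n (b, 0) = propPhase n b := by
  simp [rotPhase, propPhase, rotPair_zero]

theorem norm2_propPair (b : (ℝ × ℝ) × ℝ) :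
    norm2 (propPair b).1.1 (propPair b).1.2 * norm2 (propPair b).2.1 (propPair b).2.2 =
      rotJacobian (b, 0) := by
  have hnorm2 (p : ℝ × ℝ) : norm2 p.1 p.2 = √(normSq p) := rfl
  have hsnd : normSq (propPair b).2 = b.2 ^ 2 * normSq b.1 := by
    simp only [normSq, propPair, Prod.smul_fst, Prod.smul_snd, smul_eq_mul]
    ring
  rw [hnorm2, hnorm2, hsnd, Real.sqrt_mul (sq_nonneg _), Real.sqrt_sq_eq_abs, mul_left_comm,
    show (propPair b).1 = b.1 from rfl, Real.mul_self_sqrt (normSq_nonneg _)]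
  simp [rotJacobian]

theorem ae_rotJacobian_zero_ne_zero :
    ∀ᵐ b : PropPairs n, ∀ i, rotJacobian (b.1 i, 0) ≠ 0 := by
  have h : ∀ᵐ b : (ℝ × ℝ) × ℝ, rotJacobian (b, 0) ≠ 0 := by
    filter_upwards [Measure.quasiMeasurePreserving_fst.ae ae_ne_zero,
      Measure.quasiMeasurePreserving_snd.ae ae_ne_zero] with b hp hl
    exact rotJacobian_ne_zero_iff.2 ⟨hl, by simp, hp⟩
  exact Measure.quasiMeasurePreserving_fst.ae
    (ae_all_iff.2 fun i => Measure.quasiMeasurePreserving_eval _ i |>.ae h)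

theorem pairDensity_propPhase (b : PropPairs n) :
    pairDensity n (propPhase n b) = ∏ i, (ENNReal.ofReal (rotJacobian (b.1 i, 0)))⁻¹ := by
  simp only [← norm2_propPair]
  refine Finset.prod_congr rfl fun i _ => ?_
  conv_rhs => rw [← regroup_fstIdx (fun i => propPair (b.1 i), b.2) i,
    ← regroup_sndIdx (fun i => propPair (b.1 i), b.2) i]
  rfl

theorem measurable_pairDensity (n : ℕ) : Measurable (pairDensity n) := by
  unfold pairDensity norm2; fun_prop

/-- The measure `∏ᵢ δ(sin (φ_i - ϕ_i))`. -/
def tildeDelta (n : ℕ) : Measure (Phase n) := sliceMeasure (rotPhase n) (rotPhaseJacobian n)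

theorem isDelta_tildeDelta (n : ℕ) : IsDelta (sinDiff n) (tildeDelta n) :=
  (deltaCoordinates_rotPhase n).isDelta

theorem delta_sinDiff (n : ℕ) : delta (sinDiff n) = tildeDelta n := by
  have hδ : ∃ ν : Measure (Phase n), IsDelta (sinDiff n) ν := ⟨_, isDelta_tildeDelta n⟩
  rw [delta, dif_pos hδ]
  exact hδ.choose_spec.unique (isDelta_tildeDelta n)

theorem tildeDelta_withDensity (n : ℕ) :
    (tildeDelta n).withDensity (fun w =>
      pairDensity n w * oddDensity fun j => coord w (oddIdx j)) = tildeKernel n := by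
  have hJ := hasJacobian_rotPhase n
  have hp := measurable_pairDensity n
  rw [tildeDelta, sliceMeasure_withDensity hJ.measurable hJ.measurable_jacobian
    (by unfold oddDensity coord; fun_prop), tildeKernel]
  simp only [rotPhase_zero]
  congr 1
  refine withDensity_congr_ae ?_
  filter_upwards [ae_rotJacobian_zero_ne_zero] with b hb
  have hodd : (fun j => coord (propPhase n b) (oddIdx j)) = b.2 :=
    funext fun j => regroup_oddIdx (fun i => propPair (b.1 i), b.2) j
  rw [hodd, pairDensity_propPhase, rotPhaseJacobian,
    ENNReal.ofReal_prod_of_nonneg fun i _ => hasJacobian_rotPair.jacobian_nonneg _, ← mul_assoc,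
    ← Finset.prod_mul_distrib, Finset.prod_eq_one, one_mul]
  exact fun i _ => ENNReal.mul_inv_cancel (ENNReal.ofReal_pos.2
    ((hasJacobian_rotPair.jacobian_nonneg _).lt_of_ne' (hb i))).ne' ENNReal.ofReal_ne_top

theorem evenKernel_eq_tildeKernel (hn : Even n) : evenKernel n = tildeKernel n := by
  have : IsEmpty (Fin (n % 2)) := by rw [Nat.even_iff.1 hn]; infer_instance
  rw [← tildeDelta_withDensity, evenKernel, delta_sinDiff]
  simp [oddDensity]

theorem oddKernel_eq_tildeKernel (hn : Odd n) : oddKernel hn = tildeKernel n := by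
  have : Unique (Fin (n % 2)) := by rw [Nat.odd_iff.1 hn]; infer_instance
  rw [← tildeDelta_withDensity, oddKernel, delta_sinDiff]
  simp only [oddDensity, Fintype.prod_unique]
  rfl

end

/-! ### The normal operator -/

section Normal

variable {n : ℕ} {ι : Type}

theorem ray_focal (c : Fin n → ι) {α : ι → ℝ} (hα : ∀ i, α i ≠ 0) (z : Phase n) (u : Fin n → ℝ) :
    ray c α (focal c α z) u = z - rays c (α, z.2 - u) := by
  refine ext_coord (funext fun k => Prod.ext ?_ ?_)
  · have := hα (c k)
    simp only [coord, ray, focal, rays, Prod.fst_sub, Pi.sub_apply]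
    field_simp
    ring
  · simp [coord, ray, rays]

theorem toReal_couplingDensity (c : Fin n → ι) (α : ι → ℝ) :
    (couplingDensity c α).toReal = (∏ k, |α (c k)|)⁻¹ := by
  simp [couplingDensity, ENNReal.toReal_prod]

theorem couplingDensity_lt_top (c : Fin n → ι) {α : ι → ℝ} (hα : ∀ i, α i ≠ 0) :
    couplingDensity c α < ⊤ :=
  ENNReal.prod_lt_top fun k _ => by simpa using hα (c k)

theorem etransform_focal (c : Fin n → ι) {α : ι → ℝ} (hα : ∀ i, α i ≠ 0) (g : Phase n → ℝ≥0∞)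
    (z : Phase n) :
    etransform c g α (focal c α z) = couplingDensity c α * ∫⁻ v, g (z - rays c (α, v)) := by
  rw [etransform, couplingDensity, ENNReal.prod_inv_distrib (by simp [Set.Pairwise])]
  simp_rw [ray_focal c hα]
  rw [lintegral_sub_left_eq_self (fun v => g (z - rays c (α, v))) z.2]

theorem transform_focal (c : Fin n → ι) {α : ι → ℝ} (hα : ∀ i, α i ≠ 0) (f : Phase n → ℂ)
    (z : Phase n) :
    transform c f α (focal c α z) =
      (couplingDensity c α).toReal • ∫ v, f (z - rays c (α, v)) := by
  rw [transform, toReal_couplingDensity]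
  simp_rw [ray_focal c hα]
  rw [integral_sub_left_eq_self (fun v => f (z - rays c (α, v))) volume z.2]

variable [Fintype ι] {c : Fin n → ι} {K : Measure (Phase n)} {S : Set (ι → ℝ)}

theorem rayMeasure_restrict_prod_univ (c : Fin n → ι) (hS : MeasurableSet S) :
    (rayMeasure c).restrict (S ×ˢ Set.univ) =
      ((volume.restrict S).withDensity (couplingDensity c)).prod volume := by
  rw [rayMeasure, restrict_withDensity (hS.prod .univ), Measure.volume_eq_prod,
    ← Measure.prod_restrict, Measure.restrict_univ,
    prod_withDensity_left (measurable_couplingDensity c)]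

theorem setLIntegral_rayMeasure (c : Fin n → ι) (hS : MeasurableSet S)
    {g : (ι → ℝ) × (Fin n → ℝ) → ℝ≥0∞} (hg : Measurable g) :
    ∫⁻ a in S ×ˢ Set.univ, g a ∂rayMeasure c =
      ∫⁻ α in S, couplingDensity c α * ∫⁻ v, g (α, v) := by
  rw [rayMeasure_restrict_prod_univ c hS, lintegral_prod _ hg.aemeasurable,
    lintegral_withDensity_eq_lintegral_mul _ (measurable_couplingDensity c)
      hg.lintegral_prod_right']
  rfl

theorem edual_etransform (hK : MeasurePreserving (rays c) (rayMeasure c) K) {g : Phase n → ℝ≥0∞}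
    (hg : Measurable g) (z : Phase n) : edual c (etransform c g) z = econv K g z := by
  have h := setLIntegral_rayMeasure c .univ (g := fun a => g (z - rays c a)) (by fun_prop)
  rw [Set.univ_prod_univ, setLIntegral_univ, setLIntegral_univ] at h
  rw [econv, ← hK.lintegral_comp (by fun_prop), h, edual]
  exact lintegral_congr_ae (ae_pi_ne_zero.mono fun α hα => etransform_focal c hα g z)

theorem integrableOn_transform_focal_and_setIntegral_eq (hS : MeasurableSet S)
    (hK : MeasurePreserving (rays c) ((rayMeasure c).restrict (S ×ˢ Set.univ)) K) {f : Phase n → ℂ}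
    {z : Phase n} (hf : Integrable (fun w => f (z - w)) K) :
    IntegrableOn (fun α => transform c f α (focal c α z)) S ∧
      ∫ α in S, transform c f α (focal c α z) = conv K f z := by
  have hfin : ∀ᵐ α ∂volume.restrict S, couplingDensity c α < ⊤ :=
    ae_restrict_of_ae (ae_pi_ne_zero.mono fun α hα => couplingDensity_lt_top c hα)
  have hcongr : (fun α => transform c f α (focal c α z)) =ᵐ[volume.restrict S]
      fun α => (couplingDensity c α).toReal • ∫ v, f (z - rays c (α, v)) :=
    ae_restrict_of_ae (ae_pi_ne_zero.mono fun α hα => transform_focal c hα f z)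
  rw [rayMeasure_restrict_prod_univ c hS] at hK
  have hint := (hK.integrable_comp hf.aestronglyMeasurable).2 hf
  constructor
  · rw [IntegrableOn, integrable_congr hcongr]
    exact (integrable_withDensity_iff_integrable_smul' (measurable_couplingDensity c) hfin).1
      hint.integral_prod_left
  · rw [integral_congr_ae hcongr, ← integral_withDensity_eq_integral_toReal_smul
      (measurable_couplingDensity c) hfin, conv, ← hK.map_eq,
      integral_map hK.aemeasurable (hK.map_eq ▸ hf.aestronglyMeasurable)]
    exact (integral_prod _ hint).symm

theorem integrable_transform_focal_and_dual_eq
    (hK : MeasurePreserving (rays c) (rayMeasure c) K) {f : Phase n → ℂ} {z : Phase n}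
    (hf : Integrable (fun w => f (z - w)) K) :
    Integrable (fun α => transform c f α (focal c α z)) ∧
      dual c (transform c f) z = conv K f z := by
  have h := integrableOn_transform_focal_and_setIntegral_eq (S := Set.univ) .univ
    (by rwa [Set.univ_prod_univ, Measure.restrict_univ]) hf
  rwa [integrableOn_univ, setIntegral_univ] at h

end Normal

section Truncation

variable {n : ℕ} {ι : Type}

/-- The parameters bounded by `A` at the variables in `T`. -/
def paramBox (c : Fin n → ι) (T : Set (Fin n)) (A : ℝ) : Set (ι → ℝ) :=
  {α | ∀ k ∈ T, |α (c k)| ≤ A}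

/-- The points with `|u_k| ≤ A |x_k - u_k|` for all `k` in `T`: those on the rays with parameters in
`paramBox c T A`. -/
def coneBox (T : Set (Fin n)) (A : ℝ) : Set (Phase n) :=
  {w | ∀ k ∈ T, |w.2 k| ≤ A * |w.1 k - w.2 k|}

theorem measurableSet_paramBox (c : Fin n → ι) (T : Set (Fin n)) (A : ℝ) :
    MeasurableSet (paramBox c T A) := by
  simp only [paramBox, Set.ofPred_forall]
  exact .iInter fun k => .iInter fun _ => measurableSet_le (by fun_prop) (by fun_prop)

theorem measurableSet_coneBox (T : Set (Fin n)) (A : ℝ) : MeasurableSet (coneBox T A) := by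
  simp only [coneBox, Set.ofPred_forall]
  exact .iInter fun k => .iInter fun _ => measurableSet_le (by fun_prop) (by fun_prop)

theorem rays_mem_coneBox_iff {c : Fin n → ι} {T : Set (Fin n)} {A : ℝ}
    {a : (ι → ℝ) × (Fin n → ℝ)} (hα : ∀ i, a.1 i ≠ 0) (hv : ∀ k, a.2 k ≠ 0) :
    rays c a ∈ coneBox T A ↔ a.1 ∈ paramBox c T A := by
  refine forall₂_congr fun k _ => ?_
  have hdiff : (rays c a).1 k - (rays c a).2 k = -(a.2 k / a.1 (c k)) := by
    simp only [rays]
    ring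
  rw [hdiff, abs_neg, abs_div, ← mul_div_assoc, le_div_iff₀ (abs_pos.2 (hα _)), mul_comm]
  exact mul_le_mul_iff_left₀ (abs_pos.2 (hv k))

theorem measurePreserving_rays_restrict [Fintype ι] {c : Fin n → ι} {K : Measure (Phase n)}
    (hK : MeasurePreserving (rays c) (rayMeasure c) K) (T : Set (Fin n)) (A : ℝ) :
    MeasurePreserving (rays c) ((rayMeasure c).restrict (paramBox c T A ×ˢ Set.univ))
      (K.restrict (coneBox T A)) := by
  have hmem : ∀ᵐ a ∂rayMeasure c, rays c a ∈ coneBox T A ↔ a.1 ∈ paramBox c T A :=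
    (withDensity_absolutelyContinuous _ _).ae_le
      (ae_forall_ne_zero.mono fun a ha => rays_mem_coneBox_iff ha.1 ha.2)
  convert hK.restrict_preimage (measurableSet_coneBox T A) using 1
  exact Measure.restrict_congr_set <|
    eventuallyEq_set.2 (hmem.mono fun a ha => by simpa using ha.symm)

end Truncation

/-! ### Absolute convergence -/

section Decay

variable {n : ℕ} {f : Phase n → ℂ}

/-- The decay condition `f(x, u) = O(∏ₖ (1 + x_k² + u_k²)⁻¹)`, under which the integrals over the
parameters converge. -/
def HasProductDecay (f : Phase n → ℂ) : Prop :=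
  ∃ C, 0 ≤ C ∧ ∀ w, ‖f w‖ ≤ C * ∏ k, (1 + normSq (coord w k))⁻¹

theorem one_add_normSq_pos (p : ℝ × ℝ) : 0 < 1 + normSq p := by
  linarith [normSq_nonneg p]

theorem one_add_normSq_le_mul (p q : ℝ × ℝ) :
    1 + normSq p ≤ 2 * (1 + normSq q) * (1 + normSq (q - p)) := by
  simp only [normSq, Prod.fst_sub, Prod.snd_sub]
  nlinarith [sq_nonneg (q.1 + (q.1 - p.1)), sq_nonneg (q.2 + (q.2 - p.2)),
    mul_nonneg (normSq_nonneg q) (normSq_nonneg (q - p)), sq_nonneg (2 * q.1 - p.1),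
    sq_nonneg (2 * q.2 - p.2), normSq_nonneg q, normSq_nonneg (q - p)]

theorem HasProductDecay.comp_sub_left (hf : HasProductDecay f) (z : Phase n) :
    HasProductDecay fun w => f (z - w) := by
  obtain ⟨C, hC₀, hC⟩ := hf
  refine ⟨C * ∏ k, 2 * (1 + normSq (coord z k)), ?_, fun w => (hC _).trans ?_⟩
  · exact mul_nonneg hC₀ <|
      Finset.prod_nonneg fun k _ => by linarith [one_add_normSq_pos (coord z k)]
  rw [mul_assoc, ← Finset.prod_mul_distrib]
  refine mul_le_mul_of_nonneg_left (Finset.prod_le_prod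
    (fun k _ => (inv_pos.2 (one_add_normSq_pos _)).le) fun k _ => ?_) hC₀
  rw [← div_eq_mul_inv, le_div_iff₀ (one_add_normSq_pos _), inv_mul_le_iff₀ (one_add_normSq_pos _),
    mul_comm]
  exact one_add_normSq_le_mul (coord w k) (coord z k)

theorem hasProductDecay_schwartzMap (f : SchwartzMap (Phase n) ℂ) : HasProductDecay f := by
  set B := 2 ^ (2 * n) * (Finset.Iic (2 * n, 0)).sup
    (fun m => SchwartzMap.seminorm ℝ (E := Phase n) (F := ℂ) m.1 m.2) f
  have hB (w : Phase n) : (1 + ‖w‖) ^ (2 * n) * ‖f w‖ ≤ B := by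
    simpa only [norm_iteratedFDeriv_zero] using
      SchwartzMap.one_add_le_sup_seminorm_apply (𝕜 := ℝ) (m := (2 * n, 0)) le_rfl le_rfl f w
  refine ⟨2 ^ n * B, mul_nonneg (by positivity) (le_trans (by positivity) (hB 0)), fun w => ?_⟩
  have hle : ∏ k, (1 + normSq (coord w k)) ≤ 2 ^ n * (1 + ‖w‖) ^ (2 * n) :=
    calc ∏ k, (1 + normSq (coord w k)) ≤ ∏ _k : Fin n, 2 * (1 + ‖w‖) ^ 2 := by
          refine Finset.prod_le_prod (fun k _ => (one_add_normSq_pos _).le) fun k _ => ?_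
          have hk := normSq_le_two_mul_sq_norm (coord w k)
          have hw := pow_le_pow_left₀ (norm_nonneg _) (norm_coord_le w k) 2
          linarith [norm_nonneg w]
      _ = 2 ^ n * (1 + ‖w‖) ^ (2 * n) := by simp [mul_pow, pow_mul]
  rw [Finset.prod_inv_distrib, ← div_eq_mul_inv,
    le_div_iff₀ (Finset.prod_pos fun k _ => one_add_normSq_pos _)]
  calc ‖f w‖ * ∏ k, (1 + normSq (coord w k))
      ≤ ‖f w‖ * (2 ^ n * (1 + ‖w‖) ^ (2 * n)) := by gcongr
    _ = 2 ^ n * ((1 + ‖w‖) ^ (2 * n) * ‖f w‖) := by ring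
    _ ≤ 2 ^ n * B := by gcongr; exact hB w

theorem HasProductDecay.integrable_comp_ray {ι : Type} (hf : HasProductDecay f)
    (hfm : Measurable f) (c : Fin n → ι) (α : ι → ℝ) (xbar : Fin n → ℝ) :
    Integrable fun u => f (ray c α xbar u) := by
  obtain ⟨C, hC₀, hC⟩ := hf
  refine Integrable.mono' (g := fun u : Fin n → ℝ => C * ∏ k, (1 + u k ^ 2)⁻¹)
    ((Integrable.fintype_prod fun _ => integrable_inv_one_add_sq).const_mul C)
    (hfm.comp (by unfold ray; fun_prop)).aestronglyMeasurable
    (ae_of_all _ fun u => (hC _).trans (mul_le_mul_of_nonneg_left (Finset.prod_le_prod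
      (fun k _ => (inv_pos.2 (one_add_normSq_pos _)).le) fun k _ =>
        inv_anti₀ (by positivity) ?_) hC₀))
  simp only [normSq, coord, ray]
  linarith [sq_nonneg (1 / α (c k) * xbar k + (1 - 1 / α (c k)) * u k)]

end Decay

section Convergence

theorem one_add_normSq_rayPoint (α v : ℝ) :
    1 + normSq (rayPoint (α, v)) = 1 + (√((1 - 1 / α) ^ 2 + 1) * v) ^ 2 := by
  rw [mul_pow, Real.sq_sqrt (by positivity), normSq, rayPoint]
  ring

theorem integrable_inv_one_add_normSq_rayPoint (α : ℝ) :
    Integrable fun v : ℝ => (1 + normSq (rayPoint (α, v)))⁻¹ := by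
  simp_rw [one_add_normSq_rayPoint]
  exact integrable_inv_one_add_sq.comp_mul_left' (Real.sqrt_pos.2 (by positivity)).ne'

theorem integral_inv_one_add_normSq_rayPoint (α : ℝ) :
    ∫ v : ℝ, (1 + normSq (rayPoint (α, v)))⁻¹ = Real.pi / √((1 - 1 / α) ^ 2 + 1) := by
  simp_rw [one_add_normSq_rayPoint]
  rw [Measure.integral_comp_mul_left (fun v : ℝ => (1 + v ^ 2)⁻¹), integral_univ_inv_one_add_sq,
    abs_of_nonneg (by positivity), smul_eq_mul, inv_mul_eq_div]

theorem inv_abs_mul_integral_rayPoint_le {α : ℝ} (hα : α ≠ 0) :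
    |α|⁻¹ * ∫ v : ℝ, (1 + normSq (rayPoint (α, v)))⁻¹ ≤ 2 * Real.pi * (√(1 + α ^ 2))⁻¹ := by
  have : 0 < |α| := abs_pos.2 hα
  have hsqrt : √(1 + α ^ 2) ≤ 2 * (|α| * √((1 - 1 / α) ^ 2 + 1)) := by
    refine Real.sqrt_le_iff.2 ⟨by positivity, ?_⟩
    have hsq : α ^ 2 * ((1 - 1 / α) ^ 2 + 1) = (α - 1) ^ 2 + α ^ 2 := by field_simp
    rw [mul_pow, mul_pow, Real.sq_sqrt (by positivity), sq_abs, hsq]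
    nlinarith [sq_nonneg (7 * α - 4)]
  rw [integral_inv_one_add_normSq_rayPoint, ← div_eq_mul_inv, inv_mul_eq_div, div_div,
    div_le_div_iff₀ (by positivity) (by positivity)]
  nlinarith [Real.pi_pos]

variable {n : ℕ} {ι : Type}

theorem couplingDensity_mul_lintegral_prod_le (c : Fin n → ι) {α : ι → ℝ} (hα : ∀ i, α i ≠ 0) :
    couplingDensity c α * ∫⁻ v : Fin n → ℝ,
        ENNReal.ofReal (∏ k, (1 + normSq (rayPoint (α (c k), v k)))⁻¹) ≤
      ENNReal.ofReal ((2 * Real.pi) ^ n * ∏ k, (√(1 + α (c k) ^ 2))⁻¹) := by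
  have hpos (p : ℝ × ℝ) : 0 ≤ (1 + normSq p)⁻¹ := (inv_pos.2 (one_add_normSq_pos p)).le
  rw [volume_pi, ← ofReal_integral_eq_lintegral_ofReal
      (Integrable.fintype_prod fun k => integrable_inv_one_add_normSq_rayPoint (α (c k)))
      (ae_of_all _ fun _ => Finset.prod_nonneg fun _ _ => hpos _),
    integral_fintype_prod_eq_prod (fun k v => (1 + normSq (rayPoint (α (c k), v)))⁻¹),
    ← ENNReal.ofReal_toReal (couplingDensity_lt_top c hα).ne, toReal_couplingDensity,
    ← ENNReal.ofReal_mul (inv_nonneg.2 (Finset.prod_nonneg fun _ _ => abs_nonneg _)),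
    ← Finset.prod_inv_distrib, ← Finset.prod_mul_distrib]
  refine ENNReal.ofReal_le_ofReal ((Finset.prod_le_prod (fun k _ => ?_) fun k _ =>
    inv_abs_mul_integral_rayPoint_le (hα (c k))).trans_eq ?_)
  · exact mul_nonneg (by positivity) (integral_nonneg fun _ => hpos _)
  · simp [Finset.prod_mul_distrib]

theorem HasProductDecay.couplingDensity_mul_lintegral_le {g : Phase n → ℂ}
    (hg : HasProductDecay g) (c : Fin n → ι) : ∃ C, 0 ≤ C ∧ ∀ α : ι → ℝ, (∀ i, α i ≠ 0) →
      couplingDensity c α * ∫⁻ v, ‖g (rays c (α, v))‖ₑ ≤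
        ENNReal.ofReal (C * ∏ k, (√(1 + α (c k) ^ 2))⁻¹) := by
  obtain ⟨C, hC₀, hC⟩ := hg
  refine ⟨C * (2 * Real.pi) ^ n, by positivity, fun α hα => ?_⟩
  calc
    _ ≤ couplingDensity c α * ∫⁻ v : Fin n → ℝ, ENNReal.ofReal C *
        ENNReal.ofReal (∏ k, (1 + normSq (rayPoint (α (c k), v k)))⁻¹) := by
      gcongr with v
      rw [← ENNReal.ofReal_mul hC₀, ← ofReal_norm]
      exact ENNReal.ofReal_le_ofReal (hC (rays c (α, v)))
    _ = ENNReal.ofReal C * (couplingDensity c α * ∫⁻ v : Fin n → ℝ,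
        ENNReal.ofReal (∏ k, (1 + normSq (rayPoint (α (c k), v k)))⁻¹)) := by
      rw [lintegral_const_mul' _ _ (by simp), mul_left_comm]
    _ ≤ ENNReal.ofReal C *
        ENNReal.ofReal ((2 * Real.pi) ^ n * ∏ k, (√(1 + α (c k) ^ 2))⁻¹) := by
      gcongr
      exact couplingDensity_mul_lintegral_prod_le c hα
    _ = _ := by rw [← ENNReal.ofReal_mul hC₀, mul_assoc]

theorem inv_sqrt_one_add_sq_le_one (a : ℝ) : (√(1 + a ^ 2))⁻¹ ≤ 1 :=
  inv_le_one_of_one_le₀ (Real.one_le_sqrt.2 (by linarith [sq_nonneg a]))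

theorem inv_sqrt_one_add_sq_mul_self (a : ℝ) :
    (√(1 + a ^ 2))⁻¹ * (√(1 + a ^ 2))⁻¹ = (1 + a ^ 2)⁻¹ := by
  rw [← mul_inv, Real.mul_self_sqrt (by positivity)]

theorem inv_sqrt_one_add_sq_le {a A : ℝ} (h : |a| ≤ A) :
    (√(1 + a ^ 2))⁻¹ ≤ √(1 + A ^ 2) * (1 + a ^ 2)⁻¹ := by
  rw [← inv_sqrt_one_add_sq_mul_self, ← mul_assoc]
  refine le_mul_of_one_le_left (by positivity) ?_
  rw [← div_eq_mul_inv, one_le_div (by positivity)]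
  exact Real.sqrt_le_sqrt (by gcongr 1 + ?_; exact sq_le_sq.2 (h.trans (le_abs_self A)))

/-- Every parameter is either truncated, at a variable in `T`, or shared by two variables. In both
cases it contributes to the integrals over the parameters at most `O((1 + α²)⁻¹)`. -/
def SharesOrTruncates (c : Fin n → ι) (T : Set (Fin n)) : Prop :=
  ∀ i, (∃ k ∈ T, c k = i) ∨ ∃ k k', k ≠ k' ∧ c k = i ∧ c k' = i

open Classical in
theorem prod_fiber_inv_sqrt_le {c : Fin n → ι} {T : Set (Fin n)} (h : SharesOrTruncates c T)
    {A : ℝ} {α : ι → ℝ} (hα : α ∈ paramBox c T A) (i : ι) :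
    ∏ _k ∈ Finset.univ.filter (c · = i), (√(1 + α i ^ 2))⁻¹ ≤ √(1 + A ^ 2) * (1 + α i ^ 2)⁻¹ := by
  have hsub {s : Finset (Fin n)} (hs : s ⊆ Finset.univ.filter (c · = i)) :
      ∏ _k ∈ Finset.univ.filter (c · = i), (√(1 + α i ^ 2))⁻¹ ≤ ∏ _k ∈ s, (√(1 + α i ^ 2))⁻¹ := by
    simp only [Finset.prod_const]
    exact pow_le_pow_of_le_one (by positivity) (inv_sqrt_one_add_sq_le_one _)
      (Finset.card_le_card hs)
  obtain ⟨k, hk, rfl⟩ | ⟨k, k', hkk', hk, hk'⟩ := h i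
  · refine (hsub (s := {k}) (by simp)).trans ?_
    simpa using inv_sqrt_one_add_sq_le (hα k hk)
  · refine (hsub (s := {k, k'}) (by simp [Finset.insert_subset_iff, hk, hk'])).trans ?_
    rw [Finset.prod_pair hkk', inv_sqrt_one_add_sq_mul_self]
    exact le_mul_of_one_le_left (by positivity)
      (Real.one_le_sqrt.2 (by linarith [sq_nonneg A]))

variable [Fintype ι]

theorem SharesOrTruncates.prod_inv_sqrt_le {c : Fin n → ι} {T : Set (Fin n)}
    (h : SharesOrTruncates c T) {A : ℝ} {α : ι → ℝ} (hα : α ∈ paramBox c T A) :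
    ∏ k, (√(1 + α (c k) ^ 2))⁻¹ ≤ √(1 + A ^ 2) ^ Fintype.card ι * ∏ i, (1 + α i ^ 2)⁻¹ := by
  classical
  rw [← Finset.prod_fiberwise' Finset.univ c fun i => (√(1 + α i ^ 2))⁻¹, ← Finset.card_univ,
    ← Finset.prod_const, ← Finset.prod_mul_distrib]
  exact Finset.prod_le_prod (fun _ _ => by positivity) fun i _ => prod_fiber_inv_sqrt_le h hα i

theorem HasProductDecay.integrable_comp_sub_restrict {c : Fin n → ι} {K : Measure (Phase n)}
    (hK : MeasurePreserving (rays c) (rayMeasure c) K) {T : Set (Fin n)}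
    (hT : SharesOrTruncates c T) {f : Phase n → ℂ} (hf : HasProductDecay f) (hfm : Measurable f)
    (A : ℝ) : Integrable f (K.restrict (coneBox T A)) := by
  obtain ⟨C, hC₀, hC⟩ := hf.couplingDensity_mul_lintegral_le c
  refine ⟨hfm.aestronglyMeasurable, ?_⟩
  have hS := measurableSet_paramBox c T A
  rw [hasFiniteIntegral_iff_enorm,
    ← (measurePreserving_rays_restrict hK T A).lintegral_comp (by fun_prop),
    setLIntegral_rayMeasure c hS (by fun_prop)]
  have hint : Integrable fun α : ι → ℝ =>
      C * (√(1 + A ^ 2) ^ Fintype.card ι * ∏ i, (1 + α i ^ 2)⁻¹) :=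
    ((Integrable.fintype_prod fun _ => integrable_inv_one_add_sq).const_mul _).const_mul _
  refine lt_of_le_of_lt (lintegral_mono_ae ?_)
    (hint.restrict (s := paramBox c T A)).lintegral_lt_top
  filter_upwards [ae_restrict_mem hS, ae_restrict_of_ae ae_pi_ne_zero] with α hαS hα
  exact (hC α hα).trans (ENNReal.ofReal_le_ofReal
    (mul_le_mul_of_nonneg_left (hT.prod_inv_sqrt_le hαS) hC₀))

end Convergence

section Couplings

variable {n : ℕ}

theorem sharesOrTruncates_barCoupling : SharesOrTruncates (barCoupling n) Set.univ :=
  fun k => .inl ⟨k, Set.mem_univ k, rfl⟩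

theorem sharesOrTruncates_tildeCoupling {T : Set (Fin n)} (hT : ∀ j, oddIdx j ∈ T) :
    SharesOrTruncates (tildeCoupling n) T := by
  refine (paramEquiv n).forall_congr_right.1 (Sum.forall.2 ⟨fun i => .inr ?_, fun j => .inl ?_⟩)
  · exact ⟨fstIdx i, sndIdx i, by simp [fstIdx, sndIdx], tildeCoupling_fstIdx i,
      tildeCoupling_sndIdx i⟩
  · exact ⟨oddIdx j, hT j, tildeCoupling_oddIdx j⟩

end Couplings

theorem normal_operator_eq_conv {n : ℕ} {ι : Type} [Fintype ι] {c : Fin n → ι}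
    {K : Measure (Phase n)} (hK : MeasurePreserving (rays c) (rayMeasure c) K)
    {T : Set (Fin n)} (hT : SharesOrTruncates c T) {f : Phase n → ℂ} (hf : HasProductDecay f)
    (hfm : Measurable f) (z : Phase n) :
    edual c (etransform c fun w => ‖f w‖ₑ) z = econv K (fun w => ‖f w‖ₑ) z ∧
    (Integrable (fun w => f (z - w)) K →
      Integrable (fun α => transform c f α (focal c α z)) ∧
      dual c (transform c f) z = conv K f z) ∧
    ∀ A : ℝ, Integrable (fun w => f (z - w)) (K.restrict (coneBox T A)) ∧
      IntegrableOn (fun α => transform c f α (focal c α z)) (paramBox c T A) ∧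
      ∫ α in paramBox c T A, transform c f α (focal c α z) =
        conv (K.restrict (coneBox T A)) f z := by
  refine ⟨edual_etransform hK hfm.enorm z, integrable_transform_focal_and_dual_eq hK, fun A => ?_⟩
  have hint := (hf.comp_sub_left z).integrable_comp_sub_restrict hK hT (by fun_prop) A
  exact ⟨hint, integrableOn_transform_focal_and_setIntegral_eq (measurableSet_paramBox c T A)
    (measurePreserving_rays_restrict hK T A) hint⟩

theorem mainTheorem9_general (n : ℕ) {f : Phase n → ℂ} (hf : HasProductDecay f)
    (hfm : Measurable f) :
    (∀ (α : Fin n → ℝ) (xbar : Fin n → ℝ), (∀ i, α i ≠ 0) →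
      Integrable fun u => f (ray (barCoupling n) α xbar u)) ∧
    (∀ (α : Fin ((n + 1) / 2) → ℝ) (xbar : Fin n → ℝ), (∀ i, α i ≠ 0) →
      Integrable fun u => f (ray (tildeCoupling n) α xbar u)) ∧
    IsDelta (sinDiff n) (delta (sinDiff n)) ∧
    (∀ z : Phase n,
      edual (barCoupling n) (etransform (barCoupling n) fun w => ‖f w‖ₑ) z =
        econv (barKernel n) (fun w => ‖f w‖ₑ) z ∧
      (Integrable (fun w => f (z - w)) (barKernel n) →
        Integrable (fun α => transform (barCoupling n) f α (focal (barCoupling n) α z)) ∧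
        dual (barCoupling n) (transform (barCoupling n) f) z = conv (barKernel n) f z) ∧
      ∀ A : ℝ,
        Integrable (fun w => f (z - w))
          ((barKernel n).restrict {w | ∀ k, |w.2 k| ≤ A * |w.1 k - w.2 k|}) ∧
        IntegrableOn (fun α => transform (barCoupling n) f α (focal (barCoupling n) α z))
          {α | ∀ k, |α k| ≤ A} ∧
        ∫ α in {α | ∀ k, |α k| ≤ A}, transform (barCoupling n) f α (focal (barCoupling n) α z) =
          conv ((barKernel n).restrict {w | ∀ k, |w.2 k| ≤ A * |w.1 k - w.2 k|}) f z) ∧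
    (Even n → ∀ z : Phase n,
      edual (tildeCoupling n) (etransform (tildeCoupling n) fun w => ‖f w‖ₑ) z =
        econv (evenKernel n) (fun w => ‖f w‖ₑ) z ∧
      Integrable (fun w => f (z - w)) (evenKernel n) ∧
      Integrable (fun α => transform (tildeCoupling n) f α (focal (tildeCoupling n) α z)) ∧
      dual (tildeCoupling n) (transform (tildeCoupling n) f) z = conv (evenKernel n) f z) ∧
    (∀ hn : Odd n, ∀ z : Phase n,
      edual (tildeCoupling n) (etransform (tildeCoupling n) fun w => ‖f w‖ₑ) z =
        econv (oddKernel hn) (fun w => ‖f w‖ₑ) z ∧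
      (Integrable (fun w => f (z - w)) (oddKernel hn) →
        Integrable (fun α => transform (tildeCoupling n) f α (focal (tildeCoupling n) α z)) ∧
        dual (tildeCoupling n) (transform (tildeCoupling n) f) z = conv (oddKernel hn) f z) ∧
      ∀ A : ℝ,
        Integrable (fun w => f (z - w)) ((oddKernel hn).restrict
          {w | |w.2 (lastIdx hn)| ≤ A * |w.1 (lastIdx hn) - w.2 (lastIdx hn)|}) ∧
        IntegrableOn (fun α => transform (tildeCoupling n) f α (focal (tildeCoupling n) α z))
          {α | |α (tildeCoupling n (lastIdx hn))| ≤ A} ∧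
        ∫ α in {α | |α (tildeCoupling n (lastIdx hn))| ≤ A},
            transform (tildeCoupling n) f α (focal (tildeCoupling n) α z) =
          conv ((oddKernel hn).restrict
            {w | |w.2 (lastIdx hn)| ≤ A * |w.1 (lastIdx hn) - w.2 (lastIdx hn)|}) f z) := by
  refine ⟨fun α xbar _ => hf.integrable_comp_ray hfm _ α xbar,
    fun α xbar _ => hf.integrable_comp_ray hfm _ α xbar,
    delta_sinDiff n ▸ isDelta_tildeDelta n, fun z => ?_, fun hn z => ?_, fun hn z => ?_⟩
  · simpa only [paramBox, coneBox, Set.mem_univ, forall_const, barCoupling, id] using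
      normal_operator_eq_conv (measurePreserving_rays_bar n) sharesOrTruncates_barCoupling hf hfm z
  · have hT : SharesOrTruncates (tildeCoupling n) ∅ := sharesOrTruncates_tildeCoupling fun j =>
      absurd j.2 (by simp [Nat.even_iff.1 hn])
    obtain ⟨habs, hdual, htrunc⟩ :=
      normal_operator_eq_conv (measurePreserving_rays_tilde n) hT hf hfm z
    have hint : Integrable (fun w => f (z - w)) (tildeKernel n) := by
      simpa [coneBox] using (htrunc 0).1
    rw [evenKernel_eq_tildeKernel hn]
    exact ⟨habs, hint, hdual hint⟩
  · have hT : SharesOrTruncates (tildeCoupling n) {lastIdx hn} :=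
      sharesOrTruncates_tildeCoupling fun j => rfl
    rw [oddKernel_eq_tildeKernel hn]
    simpa only [paramBox, coneBox, Set.mem_singleton_iff, forall_eq] using
      normal_operator_eq_conv (measurePreserving_rays_tilde n) hT hf hfm z

end Photography

end

open Photography in
theorem mainTheorem9 (n : ℕ) (f : SchwartzMap (Phase n) ℂ) :
    -- the integrals defining the two transforms of `f` converge absolutely
    (∀ (α : Fin n → ℝ) (xbar : Fin n → ℝ), (∀ i, α i ≠ 0) →
      Integrable fun u => f (ray (barCoupling n) α xbar u)) ∧
    (∀ (α : Fin ((n + 1) / 2) → ℝ) (xbar : Fin n → ℝ), (∀ i, α i ≠ 0) →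
      Integrable fun u => f (ray (tildeCoupling n) α xbar u)) ∧
    -- the product of delta functions is well defined
    IsDelta (sinDiff n) (delta (sinDiff n)) ∧
    -- (i) the normal operator of the fully decoupled transform
    (∀ z : Phase n,
      edual (barCoupling n) (etransform (barCoupling n) fun w => ‖f w‖ₑ) z =
        econv (barKernel n) (fun w => ‖f w‖ₑ) z ∧
      (Integrable (fun w => f (z - w)) (barKernel n) →
        Integrable (fun α => transform (barCoupling n) f α (focal (barCoupling n) α z)) ∧
        dual (barCoupling n) (transform (barCoupling n) f) z = conv (barKernel n) f z) ∧
      ∀ A : ℝ,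
        Integrable (fun w => f (z - w))
          ((barKernel n).restrict {w | ∀ k, |w.2 k| ≤ A * |w.1 k - w.2 k|}) ∧
        IntegrableOn (fun α => transform (barCoupling n) f α (focal (barCoupling n) α z))
          {α | ∀ k, |α k| ≤ A} ∧
        ∫ α in {α | ∀ k, |α k| ≤ A}, transform (barCoupling n) f α (focal (barCoupling n) α z) =
          conv ((barKernel n).restrict {w | ∀ k, |w.2 k| ≤ A * |w.1 k - w.2 k|}) f z) ∧
    -- (ii) the normal operator of the pairwise coupled transform, even dimension
    (Even n → ∀ z : Phase n,
      edual (tildeCoupling n) (etransform (tildeCoupling n) fun w => ‖f w‖ₑ) z =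
        econv (evenKernel n) (fun w => ‖f w‖ₑ) z ∧
      Integrable (fun w => f (z - w)) (evenKernel n) ∧
      Integrable (fun α => transform (tildeCoupling n) f α (focal (tildeCoupling n) α z)) ∧
      dual (tildeCoupling n) (transform (tildeCoupling n) f) z = conv (evenKernel n) f z) ∧
    -- (ii) the normal operator of the pairwise coupled transform, odd dimension
    (∀ hn : Odd n, ∀ z : Phase n,
      edual (tildeCoupling n) (etransform (tildeCoupling n) fun w => ‖f w‖ₑ) z =
        econv (oddKernel hn) (fun w => ‖f w‖ₑ) z ∧
      (Integrable (fun w => f (z - w)) (oddKernel hn) →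
        Integrable (fun α => transform (tildeCoupling n) f α (focal (tildeCoupling n) α z)) ∧
        dual (tildeCoupling n) (transform (tildeCoupling n) f) z = conv (oddKernel hn) f z) ∧
      ∀ A : ℝ,
        Integrable (fun w => f (z - w)) ((oddKernel hn).restrict
          {w | |w.2 (lastIdx hn)| ≤ A * |w.1 (lastIdx hn) - w.2 (lastIdx hn)|}) ∧
        IntegrableOn (fun α => transform (tildeCoupling n) f α (focal (tildeCoupling n) α z))
          {α | |α (tildeCoupling n (lastIdx hn))| ≤ A} ∧
        ∫ α in {α | |α (tildeCoupling n (lastIdx hn))| ≤ A},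
            transform (tildeCoupling n) f α (focal (tildeCoupling n) α z) =
          conv ((oddKernel hn).restrict
            {w | |w.2 (lastIdx hn)| ≤ A * |w.1 (lastIdx hn) - w.2 (lastIdx hn)|}) f z) :=
  mainTheorem9_general n (hasProductDecay_schwartzMap f) f.continuous.measurable
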